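/- **Setting.** Let $n$ be the number of workers and $0\le s<n$ the number of stragglers to be tolerated, and let $\mathbb F\in\{\mathbb R,\mathbb C\}$. A matrix $B\in\mathbb F^{n\times n}$ and a function $A$ that assigns to each $K\subseteq[n]$ a vector $A(K)\in\mathbb F^n$, with $\operatorname{supp}A(K)\subseteq K$ for $K\ne\emptyset$, satisfy the *exact computation (EC) condition* if $A(K)\cdot B=(1,\dots,1)$ for all $K\subseteq[n]$ with $|K|\ge n-s$. The *storage overhead* $d$ of $B$ is the largest number of nonzero entries in a row of $B$. Complexity is the number of arithmetic operations over $\mathbb C$: finitely many complex numbers are *computed from a set $I$ in $L$ operations* if there is a sequence $g_1,\dots,g_L$, each $g_k$ being a sum, difference, product or quotient of two elements of $I\cup\{g_1,\dots,g_{k-1}\}$, such that all these numbers lie in $I\cup\{g_1,\dots,g_L\}$. The set $I_0$ of free constants consists of the integers and all roots of unity. The complexity of encoding is the number of operations needed to compute the entries of $B$ from $I_0$; the complexity of decoding for a given $K$ is the number of operations needed to compute the entries of $A(K)$ from $I_0$ (the choice of the sequence may depend on $n,s,K$, at no cost). Let $g_s$ be the least number of operations that suffices, for every invertible generalized Vandermonde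 matrix $V=(x_i^{e_j})_{i,j=1}^s$ with $x_i\in\mathbb C$, $e_j\in\mathbb Z_{\ge0}$, to compute the entries of $V^{-1}$ from $I_0$ and the entries of $V$. Put $\omega=e^{2\pi i/n}$, index coordinates by $0,\dots,n-1$, and for $c\in\mathbb C^n$ let $B(c)$ be the matrix whose columns are $c$ and its cyclic shifts, $B(c)_{i,j}=c_{i-j \bmod n}$. **Theorem.** There is an absolute constant $C>0$ such that the following holds for all integers $0\le s<n$. 1. Let $B=B(c)$ with $c_i=\prod_{j=s+1}^{n-1}(\omega^i-\omega^j)$. There is a complex-valued $A$ such that $A,B$ satisfy the EC condition; every row of $B$ has exactly $s+1$ nonzero entries, so that $d=s+1$, and this is optimal: every complex pair that satisfies the EC condition has storage overhead at least $s+1$. Encoding takes at most $C\,s(n-s)$ operations, and for every $K$ with $|K|\ge n-s$ decoding takes at most $C\,(s\log^2 s+n\log n)$ operations (with $0\log^2 0=0$). 2. If $n\not\equiv s\pmod 2$, let $c$ be the coefficient vector (from the constant term upwards, padded with zeros) of the polynomial $\prod_{k=0}^{s-1}(x-\omega^{b+k})$, $b=\frac{n-s+1}{2}$. Then $B=B(c)$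 is real, and there is a real-valued $A$ such that $A,B$ satisfy the EC condition; every row of $B$ has exactly $s+1$ nonzero entries, so that $d=s+1$, and this is optimal among real pairs. Encoding takes at most $C\min\{s\log^2 s,\,n\log n\}$ operations, and for every $K$ with $|K|\ge n-s$ decoding takes at most $C\,(g_s+s(n-s))$ operations. -/

import Mathlib

namespace GradientCoding

open Finset

noncomputable section

/-! ### Arithmetic complexity over `ℂ` -/

/-- A computation sequence over `ℂ` from the inputs `I`: every entry is obtained by one arithmetic
operation from two numbers, each of which is an input or an earlier entry. -/
def IsComputation (I : Set ℂ) {L : ℕ} (g : Fin L → ℂ) : Prop :=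
  ∀ k : Fin L, ∃ x ∈ I ∪ g '' {j | j < k}, ∃ y ∈ I ∪ g '' {j | j < k},
    g k = x + y ∨ g k = x - y ∨ g k = x * y ∨ (y ≠ 0 ∧ g k = x / y)

/-- All numbers in `T` can be computed from the inputs `I` by one computation sequence with at
most `r` arithmetic operations. -/
def ComputableWithin (I T : Set ℂ) (r : ℝ) : Prop :=
  ∃ L : ℕ, (L : ℝ) ≤ r ∧ ∃ g : Fin L → ℂ, IsComputation I g ∧ T ⊆ I ∪ Set.range g

/-- The constants that an algorithm may use at no cost: the integers and the roots of unity. -/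
def freeConstants : Set ℂ :=
  {z | (∃ k : ℤ, z = k) ∨ ∃ m : ℕ, 0 < m ∧ z ^ m = 1}

/-- The set of entries of a matrix. -/
def entries {m n : ℕ} (M : Matrix (Fin m) (Fin n) ℂ) : Set ℂ :=
  {z | ∃ i j, z = M i j}

/-- The generalized Vandermonde matrix with nodes `x` and exponents `e`. -/
def generalizedVandermonde {s : ℕ} (x : Fin s → ℂ) (e : Fin s → ℕ) :
    Matrix (Fin s) (Fin s) ℂ :=
  Matrix.of fun i j => x i ^ e j

/-- `g_s`, the complexity of inverting an `s × s` generalized Vandermonde matrix: the least number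
of operations that suffices, for every invertible such matrix, to compute all entries of the
inverse from the entries of the matrix. -/
def vandermondeInversionCost (s : ℕ) : ℕ :=
  sInf {r : ℕ | ∀ (x : Fin s → ℂ) (e : Fin s → ℕ), (generalizedVandermonde x e).det ≠ 0 →
    ComputableWithin (freeConstants ∪ entries (generalizedVandermonde x e))
      (entries (generalizedVandermonde x e)⁻¹) r}

/-! ### Gradient coding schemes -/

/-- `A` and `B` satisfy the exact computation condition for `n` workers of which any `s` may be
stragglers: `A K` is supported on the set `K` of non-stragglers, and `A K * B` is the all-ones
vector whenever `K` has at least `n - s` elements. -/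
def ExactComputation {F : Type} [Field F] {n : ℕ} (s : ℕ) (A : Finset (Fin n) → Fin n → F)
    (B : Matrix (Fin n) (Fin n) F) : Prop :=
  (∀ K : Finset (Fin n), K.Nonempty → Function.support (A K) ⊆ (K : Set (Fin n))) ∧
    ∀ K : Finset (Fin n), n - s ≤ #K → Matrix.vecMul (A K) B = 1

/-- The storage overhead `d`: the largest number of data parts sent to a worker, that is, the
largest number of nonzero entries in a row of `B`. -/
def storageOverhead {F : Type} [Field F] {n : ℕ} (B : Matrix (Fin n) (Fin n) F) : ℕ :=
  Finset.univ.sup fun i => (Function.support (B i)).ncard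

/-- `A` and `B` satisfy the exact computation condition, every worker obtains exactly `s + 1` data
parts, and no pair that satisfies the condition has a smaller storage overhead. -/
def OptimalExactScheme {F : Type} [Field F] {n : ℕ} (s : ℕ) (A : Finset (Fin n) → Fin n → F)
    (B : Matrix (Fin n) (Fin n) F) : Prop :=
  ExactComputation s A B ∧
    (∀ i, (Function.support (B i)).ncard = s + 1) ∧ storageOverhead B = s + 1 ∧
    ∀ (A' : Finset (Fin n) → Fin n → F) (B' : Matrix (Fin n) (Fin n) F),
      ExactComputation s A' B' → s + 1 ≤ storageOverhead B'

/-! ### The explicit encoding matrices -/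

/-- The primitive root of unity `ω = exp (2πi / n)`. -/
def omega (n : ℕ) : ℂ :=
  Complex.exp (2 * Real.pi * Complex.I / n)

/-- The first column of the complex encoding matrix: the values of
`m(x) = ∏ (x - ω ^ j)`, where `s < j < n`, at the `n`-th roots of unity `ω ^ i`.
This is a codeword with support `{0, …, s}` of the Reed-Solomon code of the polynomials of degree
less than `n - s` on all `n`-th roots of unity. -/
def complexCodeword (n s : ℕ) (i : Fin n) : ℂ :=
  ∏ j ∈ Finset.Ioo s n, (omega n ^ (i : ℕ) - omega n ^ j)

/-- The generator polynomial of the real BCH code: its roots are the `s` consecutive powers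
`ω ^ b, …, ω ^ (b + s - 1)` with `b = (n - s + 1) / 2`. If `n` is even and `s` is odd they are the
powers with exponents from `n/2 - ⌊s/2⌋` to `n/2 + ⌊s/2⌋`; if `n` is odd and `s` is even, those
with exponents from `⌊n/2⌋ - s/2 + 1` to `⌊n/2⌋ + s/2`. -/
def bchGenerator (n s : ℕ) : Polynomial ℂ :=
  ∏ k ∈ Finset.range s, (Polynomial.X - Polynomial.C (omega n ^ ((n - s + 1) / 2 + k)))

/-- The matrix whose first column is `c` and whose columns are the cyclic shifts of `c`. -/
def cyclicShiftMatrix {n : ℕ} (c : Fin n → ℂ) : Matrix (Fin n) (Fin n) ℂ :=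
  Matrix.circulant c

end

end GradientCoding

/-!
The proof rests on one observation. Let `c` be a column of coefficients or values whose discrete
Fourier transform `∑ i, c i * ω ^ (e * i)` vanishes for all `e` in a set `Z`. If a polynomial `P`
has only exponents in `Z ∪ {0}`, then the values of `P` at the powers of `ω` form a vector `y` with
`y * circulant c` constant, equal to `P.coeff 0 * ∑ i, c i`. So a decoding vector for a set `S` of
`s` stragglers amounts to such a `P` that vanishes at the nodes `ω ^ k`, `k ∈ S`, and for which this
constant is nonzero.

* In the complex scheme `Z = {1, …, s}`, so `P = ∏ k ∈ S, (X - ω ^ k)` will do. Its coefficients are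
  computed by divide and conquer with FFT multiplication, and its values at all `n`-th roots of
  unity by a chirp transform. The constant is `n` times a root of unity, hence costs one operation.
* In the real scheme `Z = {b, …, b + s - 1}`, and `P = 1 + X ^ b * R`, where `R` interpolates
  `-x ^ (-b)` at the nodes of `S`. The barycentric form of `R` has weights that are, up to the
  factor `ω ^ k / n`, products over the complement of `S`, since the derivative of `X ^ n - 1` is
  known at its zeros; so `O(s * (n - s))` operations suffice without inverting a matrix. As `B` is
  real, the real part of the decoding vector decodes too. The coefficients of the generator satisfy
  a two-term recurrence because its roots form a geometric progression.

The storage overhead is at least `s + 1`: a column of `B` with at most `s` nonzero entries would be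
lost when the workers that hold them straggle, and the number of nonzero entries can be counted by
rows or by columns.
-/

namespace GradientCoding

open Finset Polynomial

section Computation

variable {I I' T T' U : Set ℂ} {x y z : ℂ} {r r' a b : ℝ}

theorem IsComputation.mono {L : ℕ} {g : Fin L → ℂ} (hg : IsComputation I g) (hI : I ⊆ I') :
    IsComputation I' g := fun k =>
  let ⟨x, hx, y, hy, h⟩ := hg k
  ⟨x, Set.union_subset_union_left _ hI hx, y, Set.union_subset_union_left _ hI hy, h⟩

theorem IsComputation.append {L M : ℕ} {g : Fin L → ℂ} {h : Fin M → ℂ}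
    (hg : IsComputation I g) (hh : IsComputation (I ∪ Set.range g) h) :
    IsComputation I (Fin.append g h) := by
  intro k
  refine Fin.addCases (fun k => ?_) (fun k => ?_) k
  · have earlier : I ∪ g '' {j | j < k} ⊆
        I ∪ Fin.append g h '' {j | j < Fin.castAdd M k} := by
      rintro w (hw | ⟨j, hj, rfl⟩)
      · exact Or.inl hw
      · exact Or.inr ⟨Fin.castAdd M j, hj, Fin.append_left g h j⟩
    obtain ⟨x, hx, y, hy, hk⟩ := hg k
    exact ⟨x, earlier hx, y, earlier hy, by rwa [Fin.append_left]⟩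
  · have earlier : (I ∪ Set.range g) ∪ h '' {j | j < k} ⊆
        I ∪ Fin.append g h '' {j | j < Fin.natAdd L k} := by
      rintro w ((hw | ⟨j, rfl⟩) | ⟨j, hj, rfl⟩)
      · exact Or.inl hw
      · exact Or.inr ⟨Fin.castAdd M j, j.isLt.trans_le (Nat.le_add_right L k),
          Fin.append_left g h j⟩
      · exact Or.inr ⟨Fin.natAdd L j, (Fin.natAdd_lt_natAdd_iff L).2 hj, Fin.append_right g h j⟩
    obtain ⟨x, hx, y, hy, hk⟩ := hh k
    exact ⟨x, earlier hx, y, earlier hy, by rwa [Fin.append_right]⟩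

theorem IsComputation.map (φ : ℂ →+* ℂ) {L : ℕ} {g : Fin L → ℂ} (hg : IsComputation I g) :
    IsComputation (φ '' I) (φ ∘ g) := by
  intro k
  obtain ⟨x, hx, y, hy, hk⟩ := hg k
  have himage : ∀ w ∈ I ∪ g '' {j | j < k}, φ w ∈ φ '' I ∪ (φ ∘ g) '' {j | j < k} := by
    intro w hw
    rw [Set.image_comp, ← Set.image_union]
    exact Set.mem_image_of_mem φ hw
  refine ⟨φ x, himage x hx, φ y, himage y hy, ?_⟩
  rcases hk with hk | hk | hk | ⟨hy0, hk⟩ <;> simp [hk]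
  simp [hy0]

namespace ComputableWithin

theorem of_subset (h : T ⊆ I) : ComputableWithin I T 0 :=
  ⟨0, by simp, Fin.elim0, fun k => k.elim0, h.trans Set.subset_union_left⟩

theorem mem (h : x ∈ I) : ComputableWithin I {x} 0 :=
  of_subset (Set.singleton_subset_iff.2 h)

theorem mono (h : ComputableWithin I T r) (hI : I ⊆ I') (hT : T' ⊆ T) (hr : r ≤ r') :
    ComputableWithin I' T' r' := by
  obtain ⟨L, hL, g, hg, hTg⟩ := h
  exact ⟨L, hL.trans hr, g, hg.mono hI,
    hT.trans (hTg.trans (Set.union_subset_union_left _ hI))⟩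

theorem mono_cost (h : ComputableWithin I T r) (hr : r ≤ r') : ComputableWithin I T r' :=
  h.mono subset_rfl subset_rfl hr

theorem mono_target (h : ComputableWithin I T r) (hT : T' ⊆ T) : ComputableWithin I T' r :=
  h.mono subset_rfl hT le_rfl

theorem trans (h : ComputableWithin I T a) (h' : ComputableWithin (I ∪ T) U b) :
    ComputableWithin I (T ∪ U) (a + b) := by
  obtain ⟨L, hL, g, hg, hT⟩ := h
  obtain ⟨M, hM, g', hg', hU⟩ := h'
  have hIT : I ∪ T ⊆ I ∪ Set.range g := Set.union_subset Set.subset_union_left hT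
  refine ⟨L + M, by push_cast; exact add_le_add hL hM, Fin.append g g',
    hg.append (hg'.mono hIT), ?_⟩
  have hrange : Set.range (Fin.append g g') = Set.range g ∪ Set.range g' := by
    rw [← Set.Sum.elim_range, ← Fin.append_comp_sumElim]
    exact (finSumFinEquiv.surjective.range_comp _).symm
  rw [hrange, ← Set.union_assoc]
  exact Set.union_subset (hT.trans Set.subset_union_left)
    (hU.trans (Set.union_subset_union_left _ hIT))

theorem bind (h : ComputableWithin I T a) (h' : ComputableWithin (I ∪ T) U b) :
    ComputableWithin I U (a + b) :=
  (h.trans h').mono_target Set.subset_union_right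

theorem union (h : ComputableWithin I T a) (h' : ComputableWithin I U b) :
    ComputableWithin I (T ∪ U) (a + b) :=
  h.trans (h'.mono Set.subset_union_left subset_rfl le_rfl)

theorem map (φ : ℂ →+* ℂ) (h : ComputableWithin I T r) :
    ComputableWithin (φ '' I) (φ '' T) r := by
  obtain ⟨L, hL, g, hg, hT⟩ := h
  refine ⟨L, hL, φ ∘ g, hg.map φ, ?_⟩
  rw [Set.range_comp, ← Set.image_union]
  exact Set.image_mono hT

theorem operation (hx : ComputableWithin I {x} a) (hy : ComputableWithin I {y} b)
    (hz : z = x + y ∨ z = x - y ∨ z = x * y ∨ (y ≠ 0 ∧ z = x / y)) :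
    ComputableWithin I {z} (a + b + 1) := by
  refine (hx.union hy).bind ⟨1, by simp, fun _ => z, fun _ => ⟨x, ?_, y, ?_, hz⟩, ?_⟩
  · exact Or.inl (Or.inr (Or.inl rfl))
  · exact Or.inl (Or.inr (Or.inr rfl))
  · exact Set.singleton_subset_iff.2 (Or.inr ⟨0, rfl⟩)

theorem add (hx : ComputableWithin I {x} a) (hy : ComputableWithin I {y} b) :
    ComputableWithin I {x + y} (a + b + 1) :=
  hx.operation hy (Or.inl rfl)

theorem sub (hx : ComputableWithin I {x} a) (hy : ComputableWithin I {y} b) :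
    ComputableWithin I {x - y} (a + b + 1) :=
  hx.operation hy (Or.inr (Or.inl rfl))

theorem mul (hx : ComputableWithin I {x} a) (hy : ComputableWithin I {y} b) :
    ComputableWithin I {x * y} (a + b + 1) :=
  hx.operation hy (Or.inr (Or.inr (Or.inl rfl)))

theorem div (hx : ComputableWithin I {x} a) (hy : ComputableWithin I {y} b) (hy0 : y ≠ 0) :
    ComputableWithin I {x / y} (a + b + 1) :=
  hx.operation hy (Or.inr (Or.inr (Or.inr ⟨hy0, rfl⟩)))

theorem image {ι : Type*} (s : Finset ι) (f : ι → ℂ)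
    (h : ∀ i ∈ s, ComputableWithin I {f i} a) : ComputableWithin I (f '' s) (#s * a) := by
  classical
  induction s using Finset.induction_on with
  | empty => simpa using of_subset (Set.empty_subset I)
  | insert i s hi ih =>
    rw [coe_insert, Set.image_insert_eq, card_insert_of_notMem hi]
    exact ((h i (mem_insert_self i s)).union (ih fun j hj => h j (mem_insert_of_mem hj))).mono_cost
      (by push_cast; linarith)

theorem range {ι : Type*} [Fintype ι] (f : ι → ℂ) (h : ∀ i, ComputableWithin I {f i} a) :
    ComputableWithin I (Set.range f) (Fintype.card ι * a) := by
  simpa using image univ f fun i _ => h i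

theorem sum {ι : Type*} (h0 : 0 ∈ I) (s : Finset ι) (f : ι → ℂ)
    (h : ∀ i ∈ s, ComputableWithin I {f i} a) :
    ComputableWithin I {∑ i ∈ s, f i} (#s * (a + 1)) := by
  classical
  induction s using Finset.induction_on with
  | empty => simpa using mem h0
  | insert i s hi ih =>
    rw [sum_insert hi, card_insert_of_notMem hi]
    exact ((h i (mem_insert_self i s)).add (ih fun j hj => h j (mem_insert_of_mem hj))).mono_cost
      (by push_cast; linarith)

theorem prod {ι : Type*} (h1 : 1 ∈ I) (s : Finset ι) (f : ι → ℂ)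
    (h : ∀ i ∈ s, ComputableWithin I {f i} a) :
    ComputableWithin I {∏ i ∈ s, f i} (#s * (a + 1)) := by
  classical
  induction s using Finset.induction_on with
  | empty => simpa using mem h1
  | insert i s hi ih =>
    rw [prod_insert hi, card_insert_of_notMem hi]
    exact ((h i (mem_insert_self i s)).mul (ih fun j hj => h j (mem_insert_of_mem hj))).mono_cost
      (by push_cast; linarith)

theorem sequence (q : ℕ → ℂ) (m : ℕ) (h0 : ComputableWithin I {q 0} b)
    (h : ∀ k < m, ComputableWithin (I ∪ {q k}) {q (k + 1)} a) :
    ComputableWithin I (q '' {k | k ≤ m}) (b + m * a) := by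
  induction m with
  | zero => simpa using h0
  | succ m ih =>
    have hstep : ComputableWithin (I ∪ q '' {k | k ≤ m}) {q (m + 1)} a :=
      (h m m.lt_succ_self).mono (Set.union_subset_union_right _
        (Set.singleton_subset_iff.2 ⟨m, le_refl m, rfl⟩)) subset_rfl le_rfl
    refine ((ih fun k hk => h k (hk.trans m.lt_succ_self)).trans hstep).mono subset_rfl ?_
      (by push_cast; linarith)
    rintro _ ⟨k, hk, rfl⟩
    rcases (Nat.le_succ_iff.1 hk) with hk | rfl
    · exact Or.inl ⟨k, hk, rfl⟩
    · exact Or.inr rfl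

theorem range_of_periodic {f : ℕ → ℂ} {N : ℕ} (hN : 0 < N) (hf : f.Periodic N)
    (h : ComputableWithin I (f '' Finset.range N) r) : ComputableWithin I (Set.range f) r := by
  refine h.mono_target ?_
  rintro _ ⟨i, rfl⟩
  exact ⟨i % N, by simpa using Nat.mod_lt i hN, hf.map_mod_nat i⟩

theorem range_coeff {p : ℂ[X]} {N : ℕ} (h0 : 0 ∈ I) (hp : p.natDegree < N)
    (h : ComputableWithin I (p.coeff '' Finset.range N) r) :
    ComputableWithin I (Set.range p.coeff) r := by
  refine (h.union (mem h0)).mono subset_rfl ?_ (by simp)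
  rintro _ ⟨m, rfl⟩
  rcases lt_or_ge m N with hm | hm
  · exact Or.inl ⟨m, by simpa using hm, rfl⟩
  · exact Or.inr (coeff_eq_zero_of_natDegree_lt (hp.trans_le hm))

end ComputableWithin

end Computation

section FreeConstants

theorem intCast_mem_freeConstants (k : ℤ) : (k : ℂ) ∈ freeConstants := Or.inl ⟨k, rfl⟩

theorem natCast_mem_freeConstants (k : ℕ) : (k : ℂ) ∈ freeConstants := Or.inl ⟨k, by simp⟩

theorem zero_mem_freeConstants : (0 : ℂ) ∈ freeConstants := by
  simpa using natCast_mem_freeConstants 0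

theorem one_mem_freeConstants : (1 : ℂ) ∈ freeConstants := by
  simpa using natCast_mem_freeConstants 1

theorem mem_freeConstants_of_pow_eq_one {z : ℂ} {m : ℕ} (hm : 0 < m) (h : z ^ m = 1) :
    z ∈ freeConstants := Or.inr ⟨m, hm, h⟩

theorem neg_mem_freeConstants {z : ℂ} (hz : z ∈ freeConstants) : -z ∈ freeConstants := by
  rcases hz with ⟨k, rfl⟩ | ⟨m, hm, h⟩
  · exact Or.inl ⟨-k, by simp⟩
  · exact mem_freeConstants_of_pow_eq_one (m := m * 2) (by omega) (by
      rw [mul_comm, pow_mul, neg_sq, ← pow_mul, mul_comm, pow_mul, h, one_pow])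

theorem pow_mem_freeConstants {z : ℂ} {m : ℕ} (hm : 0 < m) (h : z ^ m = 1) (k : ℕ) :
    z ^ k ∈ freeConstants :=
  mem_freeConstants_of_pow_eq_one hm (by rw [pow_right_comm, h, one_pow])

theorem conj_image_freeConstants_subset : starRingEnd ℂ '' freeConstants ⊆ freeConstants := by
  rintro _ ⟨z, ⟨k, rfl⟩ | ⟨m, hm, h⟩, rfl⟩
  · simpa using intCast_mem_freeConstants k
  · exact mem_freeConstants_of_pow_eq_one hm (by rw [← map_pow, h, map_one])

theorem isPrimitiveRoot_omega {n : ℕ} (hn : n ≠ 0) : IsPrimitiveRoot (omega n) n :=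
  Complex.isPrimitiveRoot_exp n hn

theorem omega_ne_zero (n : ℕ) : omega n ≠ 0 := Complex.exp_ne_zero _

theorem omega_pow_mem_freeConstants (n k : ℕ) : omega n ^ k ∈ freeConstants := by
  rcases Nat.eq_zero_or_pos n with rfl | hn
  · simpa [omega] using one_mem_freeConstants
  · exact pow_mem_freeConstants hn (isPrimitiveRoot_omega hn.ne').pow_eq_one k

end FreeConstants

section Fourier

theorem periodic_eval_pow {R : Type*} [CommSemiring R] {ζ : R} {N : ℕ} (hζ : ζ ^ N = 1)
    (p : R[X]) : Function.Periodic (fun i : ℕ => p.eval (ζ ^ i)) N := fun i => by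
  simp only [pow_add, hζ, mul_one]

theorem sum_eval_pow_mul_inv_pow {F : Type*} [Field F] {ζ : F} {N : ℕ} (hζ : IsPrimitiveRoot ζ N)
    {f : F[X]} (hf : f.natDegree < N) {m : ℕ} (hm : m < N) :
    ∑ i ∈ range N, f.eval (ζ ^ i) * (ζ⁻¹ ^ m) ^ i = N * f.coeff m := by
  have hζ0 : ζ ≠ 0 := hζ.ne_zero (by omega)
  have horthogonal : ∀ j ∈ range N, j ≠ m → ∑ i ∈ range N, (ζ ^ j * ζ⁻¹ ^ m) ^ i = 0 := by
    intro j hj hjm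
    have hne : ζ ^ j * ζ⁻¹ ^ m ≠ 1 := by
      rw [inv_pow, Ne, mul_inv_eq_one₀ (pow_ne_zero m hζ0)]
      exact fun h => hjm (hζ.pow_inj (mem_range.1 hj) hm h)
    rw [geom_sum_eq hne, mul_pow, pow_right_comm, pow_right_comm ζ⁻¹, inv_pow, hζ.pow_eq_one]
    simp
  calc ∑ i ∈ range N, f.eval (ζ ^ i) * (ζ⁻¹ ^ m) ^ i
      = ∑ i ∈ range N, ∑ j ∈ range N, f.coeff j * (ζ ^ j * ζ⁻¹ ^ m) ^ i := by
        refine sum_congr rfl fun i _ => ?_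
        rw [eval_eq_sum_range' hf, sum_mul]
        exact sum_congr rfl fun j _ => by rw [mul_pow, pow_right_comm ζ j i, mul_assoc]
    _ = ∑ j ∈ range N, f.coeff j * ∑ i ∈ range N, (ζ ^ j * ζ⁻¹ ^ m) ^ i := by
        rw [sum_comm]; simp_rw [mul_sum]
    _ = f.coeff m * ∑ i ∈ range N, (ζ ^ m * ζ⁻¹ ^ m) ^ i :=
        sum_eq_single_of_mem m (mem_range.2 hm) fun j hj hjm => by
          rw [horthogonal j hj hjm, mul_zero]
    _ = N * f.coeff m := by
        rw [← mul_pow, mul_inv_cancel₀ hζ0]; simp [mul_comm]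

theorem expand_contract_add_X_mul {R : Type*} [CommSemiring R] (p : R[X]) :
    expand R 2 (contract 2 p) + X * expand R 2 (contract 2 p.divX) = p := by
  ext m
  rcases Nat.even_or_odd' m with ⟨j, rfl | rfl⟩
  · rcases j with _ | j
    · simp [coeff_expand, coeff_contract]
    · rw [coeff_add, mul_add_one, coeff_X_mul, coeff_expand two_pos, coeff_expand two_pos,
        if_pos ⟨j + 1, by ring⟩, if_neg (by omega), coeff_contract two_ne_zero, add_zero]
      congr 1
      omega
  · rw [coeff_add, coeff_X_mul, coeff_expand two_pos, coeff_expand two_pos, if_neg (by omega),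
      if_pos ⟨j, rfl⟩, coeff_contract two_ne_zero, coeff_divX, zero_add]
    congr 1
    omega

theorem natDegree_contract_lt {R : Type*} [CommSemiring R] {p : R[X]} {q N : ℕ} (hq : q ≠ 0)
    (hN : 0 < N) (hp : p.natDegree < N * q) : (contract q p).natDegree < N := by
  refine Nat.lt_of_le_pred hN (natDegree_le_iff_coeff_eq_zero.2 fun m hm => ?_)
  rw [coeff_contract hq]
  exact coeff_eq_zero_of_natDegree_lt
    (hp.trans_le (Nat.mul_le_mul_right q (Nat.le_of_pred_lt hm)))

variable {I : Set ℂ}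

theorem computableWithin_fft (hI : freeConstants ⊆ I) (k : ℕ) {ζ : ℂ} (hζ : ζ ^ 2 ^ k = 1)
    {p : ℂ[X]} (hp : Set.range p.coeff ⊆ I) (hd : p.natDegree < 2 ^ k) :
    ComputableWithin I (Set.range fun i : ℕ => p.eval (ζ ^ i)) (2 * k * 2 ^ k) := by
  induction k generalizing ζ p with
  | zero =>
    have hpC : p = C (p.coeff 0) := eq_C_of_natDegree_eq_zero (by simpa using hd)
    refine (ComputableWithin.of_subset ?_).mono_cost (by simp)
    rintro _ ⟨i, rfl⟩
    rw [hpC]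
    exact hp ⟨0, eval_C.symm⟩
  | succ k ih =>
    have hcontract : ∀ q : ℂ[X], Set.range q.coeff ⊆ I → q.natDegree < 2 ^ (k + 1) →
        ComputableWithin I (Set.range fun i : ℕ => (contract 2 q).eval ((ζ ^ 2) ^ i))
          (2 * k * 2 ^ k) := by
      intro q hq hqd
      refine ih (by rw [← pow_mul, ← pow_succ', hζ]) ?_
        (natDegree_contract_lt two_ne_zero (by positivity) (by rwa [← pow_succ]))
      rintro _ ⟨m, rfl⟩
      rw [coeff_contract two_ne_zero]
      exact hq ⟨_, rfl⟩
    have hdivX : Set.range p.divX.coeff ⊆ I := by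
      rintro _ ⟨m, rfl⟩
      rw [coeff_divX]
      exact hp ⟨_, rfl⟩
    have hbutterfly : ∀ i : ℕ, p.eval (ζ ^ i) = (contract 2 p).eval ((ζ ^ 2) ^ i) +
        ζ ^ i * (contract 2 p.divX).eval ((ζ ^ 2) ^ i) := by
      intro i
      conv_lhs => rw [← expand_contract_add_X_mul p]
      rw [eval_add, eval_mul, eval_X, expand_eval, expand_eval, pow_right_comm]
    have hhalves := (hcontract p hp hd).union
      (hcontract p.divX hdivX (by rw [natDegree_divX_eq_natDegree_tsub_one]; omega))
    have hvalues := hhalves.bind (ComputableWithin.image (range (2 ^ (k + 1)))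
      (fun i => p.eval (ζ ^ i)) (a := 2) fun i _ => by
        rw [hbutterfly]
        have hroot := pow_mem_freeConstants (by positivity) hζ i
        refine ((ComputableWithin.mem ?_).add
          ((ComputableWithin.mem ?_).mul (ComputableWithin.mem ?_))).mono_cost (by norm_num)
        · exact Or.inr (Or.inl ⟨i, rfl⟩)
        · exact Or.inl (hI hroot)
        · exact Or.inr (Or.inr ⟨i, rfl⟩))
    refine (hvalues.range_of_periodic (by positivity) (periodic_eval_pow hζ p)).mono_cost
      (le_of_eq ?_)
    rw [card_range]
    push_cast
    ring

theorem computableWithin_inverse_fft (hI : freeConstants ⊆ I) (k : ℕ) {ζ : ℂ}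
    (hζ : IsPrimitiveRoot ζ (2 ^ k)) {f : ℂ[X]} (hf : f.natDegree < 2 ^ k)
    (hvalues : Set.range (fun i : ℕ => f.eval (ζ ^ i)) ⊆ I) :
    ComputableWithin I (Set.range f.coeff) ((2 * k + 1) * 2 ^ k) := by
  have hN : ((2 ^ k : ℕ) : ℂ) ≠ 0 := Nat.cast_ne_zero.2 (by positivity)
  set v : ℂ[X] := ofFn (2 ^ k) fun i => f.eval (ζ ^ (i : ℕ)) with hv
  have hvd : v.natDegree < 2 ^ k := ofFn_natDegree_lt Nat.one_le_two_pow _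
  have hvI : Set.range v.coeff ⊆ I := by
    rintro _ ⟨i, rfl⟩
    rcases lt_or_ge i (2 ^ k) with hi | hi
    · rw [hv, ofFn_coeff_eq_val_of_lt _ hi]
      exact hvalues ⟨i, rfl⟩
    · rw [hv, ofFn_coeff_eq_zero_of_ge _ hi]
      exact hI zero_mem_freeConstants
  have hinv : ∀ m < 2 ^ k, f.coeff m = v.eval (ζ⁻¹ ^ m) / (2 ^ k : ℕ) := by
    intro m hm
    rw [eq_div_iff hN, mul_comm, ← sum_eval_pow_mul_inv_pow hζ hf hm, eval_eq_sum_range' hvd]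
    exact sum_congr rfl fun i hi => by rw [hv, ofFn_coeff_eq_val_of_lt _ (mem_range.1 hi)]
  have hfft := computableWithin_fft hI k (by rw [inv_pow, hζ.pow_eq_one, inv_one]) hvI hvd
  refine ComputableWithin.range_coeff (hI zero_mem_freeConstants) hf ?_
  refine (hfft.bind (ComputableWithin.image _ f.coeff (a := 1) fun m hm => ?_)).mono_cost
    (le_of_eq (by rw [card_range]; push_cast; ring))
  rw [hinv m (mem_range.1 hm)]
  refine ((ComputableWithin.mem ?_).div (ComputableWithin.mem ?_) hN).mono_cost (by norm_num)
  · exact Or.inr ⟨m, rfl⟩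
  · exact Or.inl (hI (natCast_mem_freeConstants _))

theorem computableWithin_coeff_mul (hI : freeConstants ⊆ I) (k : ℕ) {p q : ℂ[X]}
    (hp : Set.range p.coeff ⊆ I) (hq : Set.range q.coeff ⊆ I)
    (hpq : p.natDegree + q.natDegree < 2 ^ k) :
    ComputableWithin I (Set.range (p * q).coeff) ((6 * k + 2) * 2 ^ k) := by
  obtain ⟨ζ, hζ⟩ : ∃ ζ : ℂ, IsPrimitiveRoot ζ (2 ^ k) :=
    ⟨_, Complex.isPrimitiveRoot_exp (2 ^ k) (by positivity)⟩
  have hfactors := (computableWithin_fft hI k hζ.pow_eq_one hp (by omega)).union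
    (computableWithin_fft hI k hζ.pow_eq_one hq (by omega))
  have hvalues := hfactors.bind (ComputableWithin.range_of_periodic (by positivity)
    (periodic_eval_pow hζ.pow_eq_one (p * q))
    (ComputableWithin.image (range (2 ^ k)) _ (a := 1) fun i _ => by
      rw [eval_mul]
      refine ((ComputableWithin.mem ?_).mul (ComputableWithin.mem ?_)).mono_cost (by norm_num)
      · exact Or.inr (Or.inl ⟨i, rfl⟩)
      · exact Or.inr (Or.inr ⟨i, rfl⟩)))
  refine (hvalues.bind (computableWithin_inverse_fft (hI.trans Set.subset_union_left) k hζ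
    (natDegree_mul_le.trans_lt hpq) Set.subset_union_right)).mono_cost (le_of_eq ?_)
  rw [card_range]
  push_cast
  ring

open Lagrange in
theorem computableWithin_coeff_nodal {ι : Type*} (hI : freeConstants ⊆ I) {r : ι → ℂ} (k : ℕ)
    {S : Finset ι} (hr : ∀ i ∈ S, r i ∈ I) (hS : #S ≤ 2 ^ k) :
    ComputableWithin I (Set.range (nodal S r).coeff) ((6 * k ^ 2 + 22 * k + 2) * 2 ^ k) := by
  classical
  induction k generalizing S with
  | zero =>
    have hdeg : (nodal S r).natDegree < 2 := by rw [natDegree_nodal]; omega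
    refine (ComputableWithin.range_coeff (hI zero_mem_freeConstants) hdeg
      (ComputableWithin.image _ _ (a := 1) fun m hm => ?_)).mono_cost (by norm_num)
    have hm : m < 2 := mem_range.1 hm
    have hfree : ∀ z ∈ freeConstants, ComputableWithin I {z} 1 := fun z hz =>
      (ComputableWithin.mem (hI hz)).mono_cost zero_le_one
    rcases S.eq_empty_or_nonempty with rfl | hne
    · interval_cases m
      · simpa using hfree 1 one_mem_freeConstants
      · simpa [coeff_one] using hfree 0 zero_mem_freeConstants
    · obtain ⟨i, rfl⟩ := card_eq_one.1 (le_antisymm hS hne.card_pos)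
      interval_cases m
      · simpa [nodal] using (ComputableWithin.mem (hI zero_mem_freeConstants)).sub
          (ComputableWithin.mem (hr i (mem_singleton_self i)))
      · simpa [nodal] using hfree 1 one_mem_freeConstants
  | succ k ih =>
    obtain ⟨S₁, hS₁, hcard⟩ : ∃ S₁ ⊆ S, #S₁ = #S / 2 := exists_subset_card_eq (by omega)
    have hcard' : #(S \ S₁) = #S - #S / 2 := by rw [card_sdiff_of_subset hS₁, hcard]
    rw [pow_succ] at hS
    have hfactors := (ih (S := S \ S₁) (fun i hi => hr i (sdiff_subset hi)) (by omega)).union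
      (ih (fun i hi => hr i (hS₁ hi)) (by omega))
    have hprod := hfactors.bind (computableWithin_coeff_mul (hI.trans Set.subset_union_left)
      (k + 2) (fun x hx => Or.inr (Or.inl hx)) (fun x hx => Or.inr (Or.inr hx)) (by
        rw [natDegree_nodal, natDegree_nodal]
        have := Nat.one_le_two_pow (n := k)
        rw [pow_add]
        omega))
    rw [nodal, nodal, prod_sdiff hS₁] at hprod
    exact hprod.mono_cost (le_of_eq (by push_cast; ring))

/-- The coefficients of `∑ ζ ^ j ^ 2 * X ^ j`, where `j < N`: a quadratic chirp, by which a
convolution turns into a discrete Fourier transform of arbitrary length. -/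
noncomputable def chirp {F : Type*} [Field F] [DecidableEq F] (ζ : F) (N : ℕ) : F[X] :=
  ofFn N fun j => ζ ^ (j : ℕ) ^ 2

/-- The polynomial `p` of degree less than `n`, with its coefficients divided by a quadratic chirp
and listed in the reverse order. -/
noncomputable def reverseDechirp {F : Type*} [Field F] [DecidableEq F] (ζ : F) (n : ℕ)
    (p : F[X]) : F[X] :=
  ofFn n fun j => p.coeff (n - 1 - j) / ζ ^ (n - 1 - j) ^ 2

theorem eval_sq_pow_eq_coeff_mul_chirp_div {F : Type*} [Field F] [DecidableEq F] {ζ : F}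
    (hζ : ζ ≠ 0) {n i : ℕ} {p : F[X]} (hp : p.natDegree < n) (hi : i < n) :
    p.eval ((ζ ^ 2) ^ i) =
      (reverseDechirp ζ n p * chirp ζ (2 * n)).coeff (n - 1 + i) / ζ ^ i ^ 2 := by
  have hcoeff : (reverseDechirp ζ n p * chirp ζ (2 * n)).coeff (n - 1 + i) =
      ∑ m ∈ range n, p.coeff (n - 1 - m) / ζ ^ (n - 1 - m) ^ 2 * ζ ^ (n - 1 - m + i) ^ 2 := by
    rw [coeff_mul, Nat.sum_antidiagonal_eq_sum_range_succ_mk]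
    refine (sum_subset (range_subset_range.2 (by omega)) fun m _ hm => ?_).symm.trans
      (sum_congr rfl fun m hm => ?_)
    · rw [reverseDechirp, ofFn_coeff_eq_zero_of_ge _ (by simpa using hm), zero_mul]
    · have hm : m < n := mem_range.1 hm
      rw [reverseDechirp, chirp, ofFn_coeff_eq_val_of_lt _ hm,
        ofFn_coeff_eq_val_of_lt _ (by omega)]
      congr 4
      simp only
      omega
  rw [hcoeff, sum_range_reflect fun j => p.coeff j / ζ ^ j ^ 2 * ζ ^ (j + i) ^ 2,
    eval_eq_sum_range' hp, sum_div]
  refine sum_congr rfl fun j _ => ?_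
  rw [show (j + i) ^ 2 = j ^ 2 + i ^ 2 + 2 * i * j by ring]
  field_simp
  ring

theorem computableWithin_eval_pow (hI : freeConstants ⊆ I) {n k : ℕ} (hk : 3 * n ≤ 2 ^ k)
    {ω : ℂ} (hω : ω ^ n = 1) {p : ℂ[X]} (hp : Set.range p.coeff ⊆ I) (hd : p.natDegree < n) :
    ComputableWithin I (Set.range fun i : ℕ => p.eval (ω ^ i)) ((6 * k + 2) * 2 ^ k + 2 * n) := by
  have hn : 0 < n := by omega
  obtain ⟨ζ, rfl⟩ : ∃ ζ, ζ ^ 2 = ω := IsAlgClosed.exists_pow_nat_eq ω two_pos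
  have hζ0 : ζ ≠ 0 := by rintro rfl; simp [hn.ne'] at hω
  have hζI : ∀ j, ζ ^ j ∈ I := fun j =>
    hI (pow_mem_freeConstants (m := 2 * n) (by omega) (by rw [pow_mul, hω]) j)
  have hchirpI : Set.range (chirp ζ (2 * n)).coeff ⊆ I := by
    rintro _ ⟨m, rfl⟩
    rcases lt_or_ge m (2 * n) with hm | hm
    · rw [chirp, ofFn_coeff_eq_val_of_lt _ hm]
      exact hζI _
    · rw [chirp, ofFn_coeff_eq_zero_of_ge _ hm]
      exact hI zero_mem_freeConstants
  have hchirpd : (chirp ζ (2 * n)).natDegree < 2 * n := ofFn_natDegree_lt (by omega) _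
  have hdechirpd : (reverseDechirp ζ n p).natDegree < n := ofFn_natDegree_lt hn _
  have hdechirp : ComputableWithin I (Set.range (reverseDechirp ζ n p).coeff) n := by
    refine (ComputableWithin.range_coeff (hI zero_mem_freeConstants) hdechirpd
      (ComputableWithin.image _ _ (a := 1) fun m hm => ?_)).mono_cost (by simp)
    rw [reverseDechirp, ofFn_coeff_eq_val_of_lt _ (mem_range.1 hm)]
    exact ((ComputableWithin.mem (hp ⟨_, rfl⟩)).div (ComputableWithin.mem (hζI _))
      (pow_ne_zero _ hζ0)).mono_cost (by norm_num)
  have hconvolution := hdechirp.bind (computableWithin_coeff_mul (q := chirp ζ (2 * n))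
    (hI.trans Set.subset_union_left) k Set.subset_union_right
    (hchirpI.trans Set.subset_union_left) (by omega))
  refine ComputableWithin.range_of_periodic hn (periodic_eval_pow hω p) ?_
  refine (hconvolution.bind (ComputableWithin.image (range n) _ (a := 1) fun i hi => ?_)).mono_cost
    (le_of_eq (by rw [card_range]; ring))
  rw [eval_sq_pow_eq_coeff_mul_chirp_div hζ0 hd (mem_range.1 hi)]
  exact ((ComputableWithin.mem (Or.inr ⟨_, rfl⟩)).div (ComputableWithin.mem (Or.inl (hζI _)))
    (pow_ne_zero _ hζ0)).mono_cost (by norm_num)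

end Fourier

section Optimality

variable {F : Type} [Field F] {n s : ℕ}

theorem ExactComputation.succ_le_card_column [DecidableEq F] (hs : s < n)
    {A : Finset (Fin n) → Fin n → F} {B : Matrix (Fin n) (Fin n) F}
    (h : ExactComputation s A B) (j : Fin n) : s + 1 ≤ #{i | B i j ≠ 0} := by
  by_contra! hlt
  set K : Finset (Fin n) := {i | B i j = 0} with hK
  have hcard : #{i | B i j ≠ 0} + #K = n := by
    have := card_filter_add_card_filter_not (s := (univ : Finset (Fin n))) (fun i => B i j ≠ 0)
    simpa only [not_not, card_univ, Fintype.card_fin] using this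
  have hsupport : Function.support (A K) ⊆ K := h.1 K (card_pos.1 (by omega))
  have hzero : Matrix.vecMul (A K) B j = 0 := by
    rw [Matrix.vecMul, dotProduct]
    refine sum_eq_zero fun i _ => ?_
    by_cases hi : B i j = 0
    · rw [hi, mul_zero]
    · have hA : A K i = 0 := by
        by_contra hA
        exact hi (by simpa [hK] using hsupport hA)
      rw [hA, zero_mul]
  rw [h.2 K (by omega)] at hzero
  exact one_ne_zero hzero

theorem ExactComputation.succ_le_storageOverhead (hs : s < n)
    {A : Finset (Fin n) → Fin n → F} {B : Matrix (Fin n) (Fin n) F}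
    (h : ExactComputation s A B) : s + 1 ≤ storageOverhead B := by
  classical
  have hrow : ∀ i, #{j | B i j ≠ 0} ≤ storageOverhead B := by
    intro i
    have hcoe : (Function.support (B i)).ncard = #{j | B i j ≠ 0} := by
      rw [← Set.ncard_coe_finset, coe_filter_univ]
      rfl
    exact hcoe ▸ le_sup (f := fun i => (Function.support (B i)).ncard) (mem_univ i)
  have hcount : #(univ : Finset (Fin n)) * (s + 1) ≤ #(univ : Finset (Fin n)) * storageOverhead B :=
    card_mul_le_card_mul' (fun i j => B i j ≠ 0) (fun j _ => h.succ_le_card_column hs j)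
      fun i _ => hrow i
  exact Nat.le_of_mul_le_mul_left hcount (by simp; omega)

theorem ncard_support_circulant (hs : s < n) {c : Fin n → F}
    (hc : ∀ i : Fin n, c i ≠ 0 ↔ (i : ℕ) ≤ s) (i : Fin n) :
    (Function.support (Matrix.circulant c i)).ncard = s + 1 := by
  have : NeZero n := ⟨by omega⟩
  have hsupport : Function.support (Matrix.circulant c i) =
      Equiv.subLeft i ⁻¹' (Finset.Iic (⟨s, hs⟩ : Fin n) : Set (Fin n)) := by
    ext j
    simp [Matrix.circulant_apply, hc, Fin.le_def]
  rw [hsupport, ← Equiv.image_symm_eq_preimage, Set.ncard_image_of_injective _ (Equiv.injective _),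
    Set.ncard_coe_finset, Fin.card_Iic]

theorem optimalExactScheme_circulant (hs : s < n) {c : Fin n → F}
    (hc : ∀ i : Fin n, c i ≠ 0 ↔ (i : ℕ) ≤ s) {A : Finset (Fin n) → Fin n → F}
    (hA : ExactComputation s A (Matrix.circulant c)) :
    OptimalExactScheme s A (Matrix.circulant c) :=
  ⟨hA, ncard_support_circulant hs hc,
    (Finset.sup_le fun i _ => (ncard_support_circulant hs hc i).le).antisymm
      (hA.succ_le_storageOverhead hs),
    fun _ _ h => h.succ_le_storageOverhead hs⟩

theorem exists_exactComputation (hs : s < n) {B : Matrix (Fin n) (Fin n) F}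
    {p : (Fin n → F) → Prop}
    (h : ∀ S : Finset (Fin n), #S = s → ∃ a, (∀ i ∈ S, a i = 0) ∧ Matrix.vecMul a B = 1 ∧ p a) :
    ∃ A, ExactComputation s A B ∧ ∀ K : Finset (Fin n), n - s ≤ #K → p (A K) := by
  have hdecoder : ∀ K : Finset (Fin n), ∃ a : Fin n → F,
      Function.support a ⊆ (K : Set (Fin n)) ∧ (n - s ≤ #K → Matrix.vecMul a B = 1 ∧ p a) := by
    intro K
    by_cases hK : n - s ≤ #K
    · obtain ⟨S, hKS, hS⟩ : ∃ S : Finset (Fin n), Kᶜ ⊆ S ∧ #S = s :=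
        exists_superset_card_eq (by rw [card_compl, Fintype.card_fin]; omega) (by simpa using hs.le)
      obtain ⟨a, haS, ha⟩ := h S hS
      exact ⟨a, fun i hi => not_not.1 fun hiK => hi (haS i (hKS (by simpa using hiK))), fun _ => ha⟩
    · exact ⟨0, by simp, fun hK' => absurd hK' hK⟩
  choose A hsupport hA using hdecoder
  exact ⟨A, ⟨fun K _ => hsupport K, fun K hK => (hA K hK).1⟩, fun K hK => (hA K hK).2⟩

end Optimality

section Circulant

theorem sum_mul_circulant {G R : Type*} [AddGroup G] [Fintype G] [NonUnitalNonAssocSemiring R]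
    (y c : G → R) (j : G) : ∑ i, y i * Matrix.circulant c i j = ∑ i, y (i + j) * c i := by
  rw [← Equiv.sum_comp (Equiv.addRight j)]
  simp [Matrix.circulant_apply]

theorem entries_circulant {n : ℕ} (c : Fin n → ℂ) : entries (Matrix.circulant c) = Set.range c := by
  ext z
  constructor
  · rintro ⟨i, j, rfl⟩
    exact ⟨i - j, rfl⟩
  · rintro ⟨i, rfl⟩
    have : NeZero n := ⟨(i.pos).ne'⟩
    exact ⟨i, 0, by rw [Matrix.circulant_apply, sub_zero]⟩

theorem vecMul_eval_pow_circulant {R : Type*} [CommRing R] {n : ℕ} {ω : R} (hω : ω ^ n = 1)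
    {c : Fin n → R} {P : R[X]}
    (hP : ∀ e ≠ 0, P.coeff e ≠ 0 → ∑ i : Fin n, c i * (ω ^ e) ^ (i : ℕ) = 0) :
    Matrix.vecMul (fun i : Fin n => P.eval (ω ^ (i : ℕ))) (Matrix.circulant c) =
      fun _ => P.coeff 0 * ∑ i, c i := by
  ext j
  have : NeZero n := ⟨j.pos.ne'⟩
  have hshift : ∀ i : Fin n, ω ^ ((i + j : Fin n) : ℕ) = ω ^ (i : ℕ) * ω ^ (j : ℕ) := fun i => by
    rw [Fin.val_add, ← pow_eq_pow_mod _ hω, pow_add]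
  have hterm : ∀ e ≠ 0,
      P.coeff e * (ω ^ (j : ℕ)) ^ e * ∑ i : Fin n, c i * (ω ^ e) ^ (i : ℕ) = 0 := by
    intro e he
    by_cases hPe : P.coeff e = 0
    · rw [hPe, zero_mul, zero_mul]
    · rw [hP e he hPe, mul_zero]
  calc Matrix.vecMul (fun i : Fin n => P.eval (ω ^ (i : ℕ))) (Matrix.circulant c) j
      = ∑ i : Fin n, P.eval (ω ^ ((i + j : Fin n) : ℕ)) * c i := sum_mul_circulant _ c j
    _ = ∑ i : Fin n, ∑ e ∈ range (P.natDegree + 1),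
          P.coeff e * (ω ^ (j : ℕ)) ^ e * (c i * (ω ^ e) ^ (i : ℕ)) := by
        refine sum_congr rfl fun i _ => ?_
        rw [hshift, eval_eq_sum_range, sum_mul]
        refine sum_congr rfl fun e _ => ?_
        rw [mul_pow, pow_right_comm ω i e]
        ring
    _ = ∑ e ∈ range (P.natDegree + 1),
          P.coeff e * (ω ^ (j : ℕ)) ^ e * ∑ i : Fin n, c i * (ω ^ e) ^ (i : ℕ) := by
        rw [sum_comm]
        simp_rw [mul_sum]
    _ = P.coeff 0 * ∑ i, c i := by
        rw [sum_eq_single_of_mem 0 (by simp) fun e _ he => hterm e he]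
        simp

theorem vecMul_eval_pow_div_circulant {F : Type*} [Field F] {n : ℕ} {ω : F} (hω : ω ^ n = 1)
    {c : Fin n → F} {P : F[X]}
    (hP : ∀ e ≠ 0, P.coeff e ≠ 0 → ∑ i : Fin n, c i * (ω ^ e) ^ (i : ℕ) = 0)
    (h0 : P.coeff 0 * ∑ i, c i ≠ 0) :
    Matrix.vecMul (fun i : Fin n => P.eval (ω ^ (i : ℕ)) / (P.coeff 0 * ∑ i, c i))
      (Matrix.circulant c) = 1 := by
  have hsmul : (fun i : Fin n => P.eval (ω ^ (i : ℕ)) / (P.coeff 0 * ∑ i, c i)) =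
      (P.coeff 0 * ∑ i, c i)⁻¹ • fun i : Fin n => P.eval (ω ^ (i : ℕ)) := by
    ext i
    rw [Pi.smul_apply, smul_eq_mul, div_eq_inv_mul]
  rw [hsmul, Matrix.smul_vecMul, vecMul_eval_pow_circulant hω hP]
  exact funext fun _ => inv_mul_cancel₀ h0

end Circulant

section ComplexScheme

open Lagrange

/-- The evaluation points of the code: the `n`-th roots of unity, indexed by the workers. -/
noncomputable def node (n : ℕ) (k : Fin n) : ℂ := omega n ^ (k : ℕ)

theorem node_mem_freeConstants {n : ℕ} (k : Fin n) : node n k ∈ freeConstants :=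
  omega_pow_mem_freeConstants n k

theorem omega_pow_order {n : ℕ} (hn : n ≠ 0) : omega n ^ n = 1 :=
  (isPrimitiveRoot_omega hn).pow_eq_one

theorem node_pow_card {n : ℕ} (k : Fin n) : node n k ^ n = 1 := by
  rw [node, pow_right_comm, omega_pow_order k.pos.ne', one_pow]

/-- The polynomial `m` whose values at the `n`-th roots of unity are the entries of
`complexCodeword`. -/
noncomputable def codewordPoly (n s : ℕ) : ℂ[X] :=
  nodal (Ioo s n) fun j => omega n ^ j

variable {n s : ℕ}

theorem complexCodeword_eq_eval (i : Fin n) :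
    complexCodeword n s i = (codewordPoly n s).eval (omega n ^ (i : ℕ)) := by
  rw [complexCodeword, codewordPoly, eval_nodal]

theorem natDegree_codewordPoly : (codewordPoly n s).natDegree = n - s - 1 := by
  rw [codewordPoly, natDegree_nodal, Nat.card_Ioo]

theorem complexCodeword_ne_zero_iff (i : Fin n) : complexCodeword n s i ≠ 0 ↔ (i : ℕ) ≤ s := by
  have hω := isPrimitiveRoot_omega i.pos.ne'
  rw [complexCodeword, prod_ne_zero_iff]
  constructor
  · intro h
    by_contra! hi
    exact h i (mem_Ioo.2 ⟨hi, i.2⟩) (sub_self _)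
  · intro hi j hj h
    rw [mem_Ioo] at hj
    have := hω.pow_inj i.2 hj.2 (sub_eq_zero.1 h)
    omega

theorem sum_complexCodeword_mul_pow {m : ℕ} (hm : m < n) :
    ∑ i : Fin n, complexCodeword n s i * ((omega n)⁻¹ ^ m) ^ (i : ℕ) =
      n * (codewordPoly n s).coeff m := by
  have hdeg : (codewordPoly n s).natDegree < n := by rw [natDegree_codewordPoly]; omega
  rw [← sum_eval_pow_mul_inv_pow (isPrimitiveRoot_omega (by omega)) hdeg hm,
    ← Fin.sum_univ_eq_sum_range
      fun i => (codewordPoly n s).eval (omega n ^ i) * ((omega n)⁻¹ ^ m) ^ i]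
  exact sum_congr rfl fun i _ => by rw [complexCodeword_eq_eval]

theorem sum_complexCodeword : ∑ i, complexCodeword n s i = n * (codewordPoly n s).coeff 0 := by
  rcases Nat.eq_zero_or_pos n with rfl | hn
  · simp
  · simpa using sum_complexCodeword_mul_pow (s := s) hn

theorem sum_complexCodeword_mul_omega_pow_eq_zero (hs : s < n) {e : ℕ} (he : e ≠ 0) (hes : e ≤ s) :
    ∑ i : Fin n, complexCodeword n s i * (omega n ^ e) ^ (i : ℕ) = 0 := by
  have hinv : omega n ^ e = (omega n)⁻¹ ^ (n - e) := by
    rw [inv_pow]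
    refine eq_inv_of_mul_eq_one_left ?_
    rw [← pow_add, Nat.add_sub_cancel' (by omega), omega_pow_order (by omega)]
  rw [hinv, sum_complexCodeword_mul_pow (by omega), coeff_eq_zero_of_natDegree_lt, mul_zero]
  rw [natDegree_codewordPoly]
  omega

theorem coeff_zero_nodal_pow_eq_one {R ι : Type*} [CommRing R] {S : Finset ι} {r : ι → R} {N : ℕ}
    (hN : Even N) (hr : ∀ i ∈ S, r i ^ N = 1) : (nodal S r).coeff 0 ^ N = 1 := by
  rw [coeff_zero_eq_eval_zero, eval_nodal, ← prod_pow]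
  exact prod_eq_one fun i hi => by rw [zero_sub, hN.neg_pow, hr i hi]

theorem coeff_zero_nodal_mul_codewordPoly_pow (hn : n ≠ 0) (S : Finset (Fin n)) :
    ((nodal S (node n)).coeff 0 * (codewordPoly n s).coeff 0) ^ (2 * n) = 1 := by
  rw [mul_pow, codewordPoly, coeff_zero_nodal_pow_eq_one (even_two_mul n),
    coeff_zero_nodal_pow_eq_one (even_two_mul n), mul_one]
  · exact fun j _ => by rw [pow_right_comm, pow_mul', omega_pow_order hn, one_pow, one_pow]
  · exact fun k _ => by rw [pow_mul', node_pow_card, one_pow]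

/-- The decoding vector of the complex scheme for the stragglers `S`: the normalized values of the
polynomial with the zeros `node n k`, where `k ∈ S`. -/
noncomputable def complexDecoder (n s : ℕ) (S : Finset (Fin n)) (i : Fin n) : ℂ :=
  (nodal S (node n)).eval (omega n ^ (i : ℕ)) /
    ((nodal S (node n)).coeff 0 * ∑ i, complexCodeword n s i)

theorem coeff_zero_nodal_mul_sum_complexCodeword_ne_zero (hn : n ≠ 0) (S : Finset (Fin n)) :
    (nodal S (node n)).coeff 0 * ∑ i, complexCodeword n s i ≠ 0 := by
  rw [sum_complexCodeword, mul_left_comm]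
  refine mul_ne_zero (Nat.cast_ne_zero.2 hn) fun h => ?_
  have hpow := coeff_zero_nodal_mul_codewordPoly_pow (s := s) hn S
  rw [h, zero_pow (by omega)] at hpow
  exact zero_ne_one hpow

theorem complexDecoder_eq_zero {S : Finset (Fin n)} {i : Fin n} (hi : i ∈ S) :
    complexDecoder n s S i = 0 := by
  rw [complexDecoder, show omega n ^ (i : ℕ) = node n i from rfl, eval_nodal_at_node hi, zero_div]

theorem vecMul_complexDecoder (hs : s < n) {S : Finset (Fin n)} (hS : #S = s) :
    Matrix.vecMul (complexDecoder n s S) (cyclicShiftMatrix (complexCodeword n s)) = 1 := by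
  refine vecMul_eval_pow_div_circulant (omega_pow_order (by omega)) (fun e he hPe => ?_)
    (coeff_zero_nodal_mul_sum_complexCodeword_ne_zero (by omega) S)
  refine sum_complexCodeword_mul_omega_pow_eq_zero hs he ?_
  have := le_natDegree_of_ne_zero hPe
  rwa [natDegree_nodal, hS] at this

theorem complexCodeword_zero_zero (n : ℕ) : complexCodeword (n + 1) 0 0 = (n + 1 : ℕ) := by
  have hω := (isPrimitiveRoot_omega n.succ_ne_zero).prod_one_sub_pow_eq_order
  rw [Nat.cast_succ, ← hω, complexCodeword, ← Ico_succ_left_eq_Ioo, prod_Ico_eq_prod_range]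
  simp [add_comm]

theorem computableWithin_complexCodeword (hs : s < n) :
    ComputableWithin freeConstants (Set.range (complexCodeword n s)) (4 * (s * (n - s))) := by
  have hsupport : Set.range (complexCodeword n s) ⊆
      complexCodeword n s '' Iic (⟨s, hs⟩ : Fin n) ∪ {0} := by
    rintro _ ⟨i, rfl⟩
    by_cases hi : (i : ℕ) ≤ s
    · exact Or.inl ⟨i, by simpa [Fin.le_def] using hi, rfl⟩
    · exact Or.inr (not_not.1 fun h => hi ((complexCodeword_ne_zero_iff i).1 h))
  rcases Nat.eq_zero_or_pos s with rfl | hs0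
  · obtain ⟨n, rfl⟩ : ∃ m, n = m + 1 := ⟨n - 1, by omega⟩
    refine (ComputableWithin.of_subset (hsupport.trans ?_)).mono_cost (by simp)
    rintro _ (⟨i, hi, rfl⟩ | rfl)
    · obtain rfl : i = 0 := by simpa using hi
      rw [complexCodeword_zero_zero]
      exact natCast_mem_freeConstants _
    · exact zero_mem_freeConstants
  · have hentry : ∀ i : Fin n, ComputableWithin freeConstants {complexCodeword n s i}
        ((n - s - 1 : ℕ) * 2) := by
      intro i
      have := ComputableWithin.prod one_mem_freeConstants (Ioo s n)
        (fun j => omega n ^ (i : ℕ) - omega n ^ j) fun j _ =>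
          (ComputableWithin.mem (omega_pow_mem_freeConstants n i)).sub
            (ComputableWithin.mem (omega_pow_mem_freeConstants n j))
      rw [Nat.card_Ioo] at this
      exact this.mono_cost (by norm_num)
    refine ((ComputableWithin.image (Iic ⟨s, hs⟩) _ fun i _ => hentry i).union
      (ComputableWithin.mem zero_mem_freeConstants)).mono subset_rfl hsupport ?_
    have h1 : (1 : ℝ) ≤ s := mod_cast hs0
    have hns : ((n - s - 1 : ℕ) : ℝ) ≤ n - s := by
      rw [Nat.cast_sub (by omega), Nat.cast_sub hs.le]
      simp
    calc (#(Iic (⟨s, hs⟩ : Fin n)) : ℝ) * ((n - s - 1 : ℕ) * 2) + 0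
        = (s + 1) * ((n - s - 1 : ℕ) * 2) := by rw [Fin.card_Iic]; push_cast; ring
      _ ≤ (s + s) * ((n - s) * 2) := by gcongr
      _ = 4 * (s * (n - s)) := by ring

theorem computableWithin_complexDecoder {S : Finset (Fin n)} {k l : ℕ} (hSn : #S < n)
    (hk : #S ≤ 2 ^ k) (hl : 3 * n ≤ 2 ^ l) :
    ComputableWithin freeConstants (Set.range (complexDecoder n s S))
      ((6 * k ^ 2 + 22 * k + 2) * 2 ^ k + (6 * l + 2) * 2 ^ l + 3 * n + 1) := by
  have hn : n ≠ 0 := by omega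
  have hcoeff := computableWithin_coeff_nodal subset_rfl k
    (fun k _ => node_mem_freeConstants k) hk
  have hvalues := hcoeff.bind (computableWithin_eval_pow Set.subset_union_left hl
    (omega_pow_order hn) Set.subset_union_right (by rwa [natDegree_nodal]))
  have hnormalizer : ComputableWithin freeConstants
      {(nodal S (node n)).coeff 0 * ∑ i, complexCodeword n s i} (0 + 0 + 1) := by
    rw [sum_complexCodeword, mul_left_comm]
    exact (ComputableWithin.mem (natCast_mem_freeConstants n)).mul (ComputableWithin.mem
      (mem_freeConstants_of_pow_eq_one (by omega) (coeff_zero_nodal_mul_codewordPoly_pow hn S)))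
  refine ((hvalues.union hnormalizer).bind (ComputableWithin.range (complexDecoder n s S)
    (a := 1) fun i => ?_)).mono_cost (le_of_eq (by rw [Fintype.card_fin]; ring))
  exact ((ComputableWithin.mem (Or.inr (Or.inl ⟨i, rfl⟩))).div (ComputableWithin.mem
    (Or.inr (Or.inr rfl))) (coeff_zero_nodal_mul_sum_complexCodeword_ne_zero hn S)).mono_cost
      (by norm_num)

theorem range_complexDecoder_one_subset (S : Finset (Fin 1)) (hS : #S = 0) :
    Set.range (complexDecoder 1 0 S) ⊆ freeConstants := by
  obtain rfl := card_eq_zero.1 hS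
  rintro _ ⟨i, rfl⟩
  have hIoo : Ioo 0 1 = (∅ : Finset ℕ) := rfl
  have hone : complexDecoder 1 0 ∅ i = 1 := by
    simp [complexDecoder, complexCodeword, hIoo]
  exact hone ▸ one_mem_freeConstants

end ComplexScheme

section Logarithms

theorem natLog_two_le_two_mul_log (m : ℕ) : (Nat.log 2 m : ℝ) ≤ 2 * Real.log m := by
  have hlog2 : 1 / 2 ≤ Real.log 2 := by linarith [Real.log_two_gt_d9]
  calc (Nat.log 2 m : ℝ) ≤ Real.log m / Real.log 2 := Real.natLog_le_logb m 2
    _ ≤ Real.log m / (1 / 2) := by gcongr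
    _ = 2 * Real.log m := by ring

theorem one_le_two_mul_log {m : ℕ} (hm : 2 ≤ m) : 1 ≤ 2 * Real.log m :=
  le_trans (mod_cast Nat.log_pos one_lt_two hm) (natLog_two_le_two_mul_log m)

theorem complexDecoder_cost_le_natLog {n s : ℕ} (hs : s < n) :
    (6 * (Nat.log 2 s + 1) ^ 2 + 22 * (Nat.log 2 s + 1) + 2) * 2 ^ (Nat.log 2 s + 1) +
        (6 * (Nat.log 2 n + 3) + 2) * 2 ^ (Nat.log 2 n + 3) + 3 * n + 1 ≤
      80 * (s * Nat.log 2 s ^ 2) + 48 * (n * Nat.log 2 n) + 224 * n := by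
  have hexpansion : (6 * (Nat.log 2 s + 1) ^ 2 + 22 * (Nat.log 2 s + 1) + 2) *
      2 ^ (Nat.log 2 s + 1) ≤ 80 * (s * Nat.log 2 s ^ 2) + 60 * n := by
    rcases Nat.eq_zero_or_pos s with rfl | hs0
    · simp
      omega
    have hpow : 2 ^ Nat.log 2 s ≤ s := Nat.pow_log_le_self 2 hs0.ne'
    have hsq : Nat.log 2 s ≤ Nat.log 2 s ^ 2 := Nat.le_self_pow two_ne_zero _
    calc _ = (6 * Nat.log 2 s ^ 2 + 34 * Nat.log 2 s + 30) * (2 * 2 ^ Nat.log 2 s) := by ring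
      _ ≤ (6 * Nat.log 2 s ^ 2 + 34 * Nat.log 2 s ^ 2 + 30) * (2 * s) := by gcongr
      _ = 80 * (s * Nat.log 2 s ^ 2) + 60 * s := by ring
      _ ≤ 80 * (s * Nat.log 2 s ^ 2) + 60 * n := by gcongr
  have hevaluation : (6 * (Nat.log 2 n + 3) + 2) * 2 ^ (Nat.log 2 n + 3) ≤
      48 * (n * Nat.log 2 n) + 160 * n := by
    calc _ = (6 * Nat.log 2 n + 20) * 8 * 2 ^ Nat.log 2 n := by ring
      _ ≤ (6 * Nat.log 2 n + 20) * 8 * n := by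
        gcongr
        exact Nat.pow_log_le_self 2 (by omega)
      _ = 48 * (n * Nat.log 2 n) + 160 * n := by ring
  omega

theorem natLog_cost_le {n s : ℕ} (hn : 2 ≤ n) :
    80 * (s * Nat.log 2 s ^ 2) + 48 * (n * Nat.log 2 n) + 224 * n ≤
      (1000 : ℝ) * (s * Real.log s ^ 2 + n * Real.log n) := by
  have hslog : 0 ≤ s * Real.log s ^ 2 := by positivity
  have hnlog : 0 ≤ n * Real.log n := mul_nonneg n.cast_nonneg (Real.log_natCast_nonneg n)
  calc 80 * (s * Nat.log 2 s ^ 2) + 48 * (n * Nat.log 2 n) + 224 * (n : ℝ)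
      = 80 * (s * Nat.log 2 s ^ 2) + 48 * (n * Nat.log 2 n) + 224 * (n * 1) := by ring
    _ ≤ 80 * (s * (2 * Real.log s) ^ 2) + 48 * (n * (2 * Real.log n)) +
          224 * (n * (2 * Real.log n)) := by
        gcongr
        · exact natLog_two_le_two_mul_log s
        · exact natLog_two_le_two_mul_log n
        · exact one_le_two_mul_log hn
    _ ≤ 1000 * (s * Real.log s ^ 2 + n * Real.log n) := by linarith

theorem pred_le_four_mul_min_log {n s : ℕ} (hs : s < n) :
    ((s - 1 : ℕ) : ℝ) ≤ 4 * min (s * Real.log s ^ 2) (n * Real.log n) := by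
  rcases (show s ≤ 1 ∨ 2 ≤ s by omega) with hs1 | hs2
  · rw [Nat.sub_eq_zero_of_le hs1, Nat.cast_zero]
    positivity
  · have hslog := one_le_two_mul_log hs2
    have hnlog := one_le_two_mul_log (hs2.trans hs.le)
    have hpred : ((s - 1 : ℕ) : ℝ) ≤ s := mod_cast Nat.sub_le s 1
    have hsn : (s : ℝ) ≤ n := mod_cast hs.le
    rw [mul_min_of_nonneg _ _ (by norm_num)]
    refine hpred.trans (le_min ?_ ?_)
    · calc (s : ℝ) = s * 1 ^ 2 := by ring
        _ ≤ s * (2 * Real.log s) ^ 2 := by gcongr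
        _ = 4 * (s * Real.log s ^ 2) := by ring
    · calc (s : ℝ) ≤ n * 1 := by rwa [mul_one]
        _ ≤ n * (4 * Real.log n) := by gcongr; linarith
        _ = 4 * (n * Real.log n) := by ring

end Logarithms

section ComplexSchemeCost

variable {n s : ℕ}

theorem computableWithin_complexDecoder_log (hs : s < n) {S : Finset (Fin n)} (hS : #S = s) :
    ComputableWithin freeConstants (Set.range (complexDecoder n s S))
      (1000 * (s * Real.log s ^ 2 + n * Real.log n)) := by
  rcases (show n = 1 ∨ 2 ≤ n by omega) with rfl | hn
  · obtain rfl : s = 0 := by omega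
    exact (ComputableWithin.of_subset (range_complexDecoder_one_subset S hS)).mono_cost (by simp)
  have hk : #S ≤ 2 ^ (Nat.log 2 s + 1) := hS ▸ (Nat.lt_pow_succ_log_self one_lt_two s).le
  have hl : 3 * n ≤ 2 ^ (Nat.log 2 n + 3) := by
    have := Nat.lt_pow_succ_log_self one_lt_two n
    rw [pow_succ] at this
    rw [pow_add]
    omega
  refine (computableWithin_complexDecoder (s := s) (hS.trans_lt hs) hk hl).mono_cost
    (le_trans ?_ (natLog_cost_le hn))
  exact_mod_cast complexDecoder_cost_le_natLog hs

theorem exists_complexScheme (hs : s < n) :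
    ∃ A : Finset (Fin n) → Fin n → ℂ,
      OptimalExactScheme s A (cyclicShiftMatrix (complexCodeword n s)) ∧
      ∀ K : Finset (Fin n), n - s ≤ #K → ComputableWithin freeConstants (Set.range (A K))
        (1000 * (s * Real.log s ^ 2 + n * Real.log n)) := by
  obtain ⟨A, hA, hcost⟩ := exists_exactComputation hs
    (p := fun a => ComputableWithin freeConstants (Set.range a)
      (1000 * (s * Real.log s ^ 2 + n * Real.log n))) fun S hS =>
    ⟨complexDecoder n s S, fun _ hi => complexDecoder_eq_zero hi, vecMul_complexDecoder hs hS,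
      computableWithin_complexDecoder_log hs hS⟩
  exact ⟨A, optimalExactScheme_circulant hs complexCodeword_ne_zero_iff hA, hcost⟩

end ComplexSchemeCost

section GapLocator

open Lagrange

variable {F ι : Type*} [Field F] [DecidableEq ι] {S : Finset ι} {v : ι → F} {b : ℕ}

/-- A locator polynomial of the nodes `v k`, where `k ∈ S`, for distinct nonzero nodes and `b ≠ 0`:
it has constant term `1`, and its other exponents lie in the interval `[b, b + #S)`. -/
noncomputable def gapLocator (S : Finset ι) (v : ι → F) (b : ℕ) : F[X] :=
  1 + X ^ b * interpolate S v fun k => -(v k ^ b)⁻¹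

theorem eval_gapLocator_at_node (hv : Set.InjOn v S) {i : ι} (hi : i ∈ S) (hvi : v i ≠ 0) :
    (gapLocator S v b).eval (v i) = 0 := by
  rw [gapLocator, eval_add, eval_one, eval_mul, eval_X_pow, eval_interpolate_at_node _ hv hi,
    mul_neg, mul_inv_cancel₀ (pow_ne_zero b hvi), add_neg_cancel]

theorem eval_gapLocator_not_at_node {x : F} (hx : ∀ i ∈ S, x ≠ v i) :
    (gapLocator S v b).eval x = 1 + x ^ b * ((∏ i ∈ S, (x - v i)) *
      ∑ i ∈ S, nodalWeight S v i * -(v i ^ b)⁻¹ / (x - v i)) := by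
  rw [gapLocator, eval_add, eval_one, eval_mul, eval_X_pow, eval_interpolate_not_at_node _ hx,
    eval_nodal]
  simp_rw [div_eq_mul_inv, mul_right_comm]

theorem coeff_zero_gapLocator (hb : b ≠ 0) : (gapLocator S v b).coeff 0 = 1 := by
  rw [gapLocator, coeff_add, coeff_one_zero, coeff_X_pow_mul', if_neg (by omega), add_zero]

theorem exponent_mem_of_coeff_gapLocator_ne_zero (hv : Set.InjOn v S) {e : ℕ} (he : e ≠ 0)
    (h : (gapLocator S v b).coeff e ≠ 0) : b ≤ e ∧ e < b + #S := by
  rw [gapLocator, coeff_add, coeff_one, if_neg he, zero_add, coeff_X_pow_mul'] at h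
  obtain ⟨hbe, hcoeff⟩ := ite_ne_right_iff.1 h
  have := (le_degree_of_ne_zero hcoeff).trans_lt (degree_interpolate_lt _ hv)
  rw [Nat.cast_lt] at this
  omega

end GapLocator

section RootsOfUnity

open Lagrange

variable {F : Type*} [Field F] {ω : F} {n : ℕ}

theorem nodal_univ_pow_eq_X_pow_sub_one (hn : n ≠ 0) (hω : IsPrimitiveRoot ω n) :
    nodal univ (fun k : Fin n => ω ^ (k : ℕ)) = X ^ n - 1 := by
  have hmonic : (X ^ n - 1 : F[X]).Monic := monic_X_pow_sub_C 1 hn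
  have hdegree : (X ^ n - 1 : F[X]).degree = n := degree_X_pow_sub_C (by omega) 1
  refine eq_of_degree_le_of_eval_index_eq (s := univ) (v := fun k : Fin n => ω ^ (k : ℕ))
    (fun i _ j _ h => Fin.ext (hω.pow_inj i.2 j.2 h)) degree_nodal.le ?_ ?_ fun k _ => ?_
  · rw [degree_nodal, hdegree, card_univ, Fintype.card_fin]
  · rw [nodal_monic.leadingCoeff, hmonic.leadingCoeff]
  · rw [eval_nodal_at_node (v := fun k : Fin n => ω ^ (k : ℕ)) (mem_univ k), eval_sub, eval_X_pow,
      pow_right_comm, hω.pow_eq_one, one_pow, eval_one, sub_self]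

theorem nodalWeight_pow (hω : IsPrimitiveRoot ω n) {S : Finset (Fin n)} {k : Fin n} (hk : k ∈ S) :
    nodalWeight S (fun k : Fin n => ω ^ (k : ℕ)) k =
      (∏ j ∈ Sᶜ, (ω ^ (k : ℕ) - ω ^ (j : ℕ))) * (ω ^ (k : ℕ) / n) := by
  have hn : n ≠ 0 := k.pos.ne'
  have : NeZero n := ⟨hn⟩
  set v : Fin n → F := fun k => ω ^ (k : ℕ) with hv
  have hderivative : (derivative (nodal S v)).eval (v k) * (nodal Sᶜ v).eval (v k) =
      n * v k ^ (n - 1) := by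
    have hprod : nodal S v * nodal Sᶜ v = X ^ n - 1 :=
      (prod_mul_prod_compl S _).trans (nodal_univ_pow_eq_X_pow_sub_one hn hω)
    have := congrArg (fun p => eval (v k) (derivative p)) hprod
    simpa [derivative_mul, eval_nodal_at_node hk, derivative_X_pow] using this
  have hcard : (n : F) ≠ 0 := hω.neZero'.out
  have hpow : v k ^ (n - 1) * v k = 1 := by
    rw [pow_sub_one_mul hn, hv, pow_right_comm, hω.pow_eq_one, one_pow]
  rw [nodalWeight_eq_eval_derivative_nodal hk, ← eval_nodal (R := F) (x := v k)]
  refine inv_eq_of_mul_eq_one_right ?_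
  rw [← mul_assoc, hderivative, mul_div_assoc', mul_assoc, hpow, mul_one, div_self hcard]

end RootsOfUnity

section BCHGenerator

open Lagrange

theorem coeff_prod_X_sub_C_geometric {R : Type*} [CommRing R] (a q : R) (s j : ℕ) :
    a * q ^ s * (1 - q ^ (j + 1)) * (∏ k ∈ range s, (X - C (a * q ^ k))).coeff (j + 1) =
      (q ^ (s + 1) - q ^ (j + 1)) * (∏ k ∈ range s, (X - C (a * q ^ k))).coeff j := by
  set p : R[X] := ∏ k ∈ range s, (X - C (a * q ^ k)) with hp
  have hscale : ∀ k, C q * X - C (a * q ^ (k + 1)) = C q * (X - C (a * q ^ k)) := fun k => by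
    rw [mul_sub, ← C_mul, pow_succ']
    congr 2
    ring
  -- Both sides are `∏ (q X - a q ^ k)` over `k ≤ s`, split off at the last and at the first factor.
  have hfunctional : p.comp (C q * X) * (C q * X - C (a * q ^ s)) =
      (C q * X - C a) * (C (q ^ s) * p) := by
    rw [hp, Polynomial.prod_comp]
    simp only [sub_comp, X_comp, C_comp]
    rw [← prod_range_succ (fun k => C q * X - C (a * q ^ k)), prod_range_succ']
    simp_rw [hscale]
    rw [prod_mul_distrib, prod_const, card_range, C_pow, pow_zero, mul_one, mul_comm]
  have hshift : C q * (X * p.comp (C q * X)) - C (a * q ^ s) * p.comp (C q * X) =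
      C (q * q ^ s) * (X * p) - C (a * q ^ s) * p := by
    simp only [C_mul] at hfunctional ⊢
    linear_combination hfunctional
  have hcoeff := congrArg (fun f => coeff f (j + 1)) hshift
  simp only [coeff_sub, coeff_C_mul, coeff_X_mul, comp_C_mul_X_coeff] at hcoeff
  linear_combination hcoeff

variable {n s : ℕ}

theorem bchGenerator_eq_nodal (n s : ℕ) :
    bchGenerator n s = nodal (range s) fun k => omega n ^ ((n - s + 1) / 2 + k) := rfl

theorem natDegree_bchGenerator (n s : ℕ) : (bchGenerator n s).natDegree = s := by
  rw [bchGenerator_eq_nodal, natDegree_nodal, card_range]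

theorem coeff_bchGenerator_self (n s : ℕ) : (bchGenerator n s).coeff s = 1 := by
  have hmonic : (bchGenerator n s).Monic := nodal_monic
  rwa [Monic, leadingCoeff, natDegree_bchGenerator] at hmonic

theorem coeff_zero_bchGenerator_pow (hn : n ≠ 0) (s : ℕ) :
    (bchGenerator n s).coeff 0 ^ (2 * n) = 1 := by
  rw [bchGenerator_eq_nodal]
  refine coeff_zero_nodal_pow_eq_one (even_two_mul n) fun k _ => ?_
  rw [pow_right_comm, pow_mul', omega_pow_order hn, one_pow, one_pow]

theorem eval_one_bchGenerator_ne_zero (hs : s < n) : (bchGenerator n s).eval 1 ≠ 0 := by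
  refine eval_nodal_not_at_node fun k hk => ?_
  rw [mem_range] at hk
  exact ((isPrimitiveRoot_omega (by omega)).pow_ne_one_of_pos_of_lt (by omega) (by omega)).symm

theorem eval_bchGenerator_eq_zero {e : ℕ} (hbe : (n - s + 1) / 2 ≤ e)
    (heb : e < (n - s + 1) / 2 + s) : (bchGenerator n s).eval (omega n ^ e) = 0 := by
  obtain ⟨k, rfl⟩ := Nat.exists_eq_add_of_le hbe
  exact eval_nodal_at_node (v := fun k => omega n ^ ((n - s + 1) / 2 + k))
    (mem_range.2 (by omega : k < s))

theorem sum_coeff_bchGenerator_mul_pow (hs : s < n) (x : ℂ) :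
    ∑ i : Fin n, (bchGenerator n s).coeff i * x ^ (i : ℕ) = (bchGenerator n s).eval x := by
  rw [Fin.sum_univ_eq_sum_range fun i => (bchGenerator n s).coeff i * x ^ i,
    ← eval_eq_sum_range' (by rwa [natDegree_bchGenerator])]

theorem coeff_succ_bchGenerator_denominator_ne_zero {j : ℕ} (hs : s < n) (hj : j < s) :
    omega n ^ ((n - s + 1) / 2 + s) * (1 - omega n ^ (j + 1)) ≠ 0 :=
  mul_ne_zero (pow_ne_zero _ (omega_ne_zero n)) (sub_ne_zero.2
    ((isPrimitiveRoot_omega (by omega)).pow_ne_one_of_pos_of_lt (by omega) (by omega)).symm)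

theorem coeff_succ_bchGenerator {j : ℕ} (hs : s < n) (hj : j < s) :
    (bchGenerator n s).coeff (j + 1) =
      (omega n ^ (s + 1) - omega n ^ (j + 1)) * (bchGenerator n s).coeff j /
        (omega n ^ ((n - s + 1) / 2 + s) * (1 - omega n ^ (j + 1))) := by
  rw [eq_div_iff (coeff_succ_bchGenerator_denominator_ne_zero hs hj), bchGenerator]
  simp only [pow_add (omega n) ((n - s + 1) / 2)]
  rw [← coeff_prod_X_sub_C_geometric]
  ring

theorem coeff_bchGenerator_ne_zero_iff (hs : s < n) (j : ℕ) :
    (bchGenerator n s).coeff j ≠ 0 ↔ j ≤ s := by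
  refine ⟨fun h => (le_natDegree_of_ne_zero h).trans_eq (natDegree_bchGenerator n s), fun hj => ?_⟩
  induction j with
  | zero =>
    intro h
    have hpow := coeff_zero_bchGenerator_pow (by omega : n ≠ 0) s
    rw [h, zero_pow (by omega)] at hpow
    exact zero_ne_one hpow
  | succ j ih =>
    rw [coeff_succ_bchGenerator hs hj]
    refine div_ne_zero (mul_ne_zero (sub_ne_zero.2 fun h => ?_) (ih (by omega)))
      (coeff_succ_bchGenerator_denominator_ne_zero hs hj)
    rw [pow_succ, pow_succ] at h
    have := (isPrimitiveRoot_omega (by omega)).pow_inj hs (by omega)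
      (mul_right_cancel₀ (omega_ne_zero n) h)
    omega

theorem conj_omega_pow {e : ℕ} (he : e ≤ n) (hn : n ≠ 0) :
    starRingEnd ℂ (omega n ^ e) = omega n ^ (n - e) := by
  have hnorm : ‖omega n ^ e‖ = 1 := by
    rw [norm_pow, Complex.norm_eq_one_of_pow_eq_one (omega_pow_order hn) hn, one_pow]
  rw [← Complex.inv_eq_conj hnorm]
  refine inv_eq_of_mul_eq_one_right ?_
  rw [← pow_add, Nat.add_sub_cancel' he, omega_pow_order hn]

theorem conj_coeff_bchGenerator (hs : s < n) (hodd : ¬ n ≡ s [MOD 2]) (j : ℕ) :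
    starRingEnd ℂ ((bchGenerator n s).coeff j) = (bchGenerator n s).coeff j := by
  have hparity : (n - s) % 2 = 1 := by
    have : ¬ n % 2 = s % 2 := hodd
    omega
  have hmap : (bchGenerator n s).map (starRingEnd ℂ) = bchGenerator n s := by
    rw [bchGenerator, Polynomial.map_prod, ← prod_range_reflect]
    refine prod_congr rfl fun k hk => ?_
    rw [mem_range] at hk
    rw [Polynomial.map_sub, map_X, map_C, conj_omega_pow (by omega) (by omega)]
    congr 4
    omega
  rw [← coeff_map, hmap]

theorem computableWithin_coeff_bchGenerator (hs : s < n) :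
    ComputableWithin freeConstants (Set.range (bchGenerator n s).coeff) ((s - 1 : ℕ) * 5) := by
  have hzero : (bchGenerator n s).coeff 0 ∈ freeConstants :=
    mem_freeConstants_of_pow_eq_one (by omega) (coeff_zero_bchGenerator_pow (by omega) s)
  have hsequence := ComputableWithin.sequence (a := 5) (bchGenerator n s).coeff (s - 1)
    (ComputableWithin.mem hzero) fun j hj => by
      have hpow : ∀ k, ComputableWithin (freeConstants ∪ {(bchGenerator n s).coeff j})
          {omega n ^ k} 0 :=
        fun k => ComputableWithin.mem (Or.inl (omega_pow_mem_freeConstants n k))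
      have hone : ComputableWithin (freeConstants ∪ {(bchGenerator n s).coeff j}) {1} 0 :=
        ComputableWithin.mem (Or.inl one_mem_freeConstants)
      rw [coeff_succ_bchGenerator hs (by omega)]
      exact ((((hpow _).sub (hpow _)).mul (ComputableWithin.mem (Or.inr rfl))).div
        ((hpow _).mul (hone.sub (hpow _)))
        (coeff_succ_bchGenerator_denominator_ne_zero hs (by omega))).mono_cost (by norm_num)
  refine (hsequence.union (ComputableWithin.of_subset (T := {1, 0}) ?_)).mono subset_rfl ?_
    (by simp)
  · rintro _ (rfl | rfl)
    exacts [one_mem_freeConstants, zero_mem_freeConstants]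
  · rintro _ ⟨j, rfl⟩
    rcases lt_trichotomy j s with hj | rfl | hj
    · exact Or.inl ⟨j, Nat.le_sub_one_of_lt hj, rfl⟩
    · exact Or.inr (Or.inl (coeff_bchGenerator_self n j))
    · exact Or.inr (Or.inr (not_not.1 fun h => hj.not_ge
        ((coeff_bchGenerator_ne_zero_iff hs j).1 h)))

end BCHGenerator

section RealPart

theorem vecMul_re_eq_one {m n : Type*} [Fintype m] {y : m → ℂ} {B : Matrix m n ℝ}
    (h : Matrix.vecMul y (B.map Complex.ofReal) = 1) :
    Matrix.vecMul (fun i => (y i).re) B = 1 := by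
  ext j
  simpa [Matrix.vecMul, dotProduct] using congrArg Complex.re (congrFun h j)

theorem computableWithin_image_re {ι : Type*} {T : Finset ι} {y : ι → ℂ} {r : ℝ}
    (h : ComputableWithin freeConstants (y '' T) r) :
    ComputableWithin freeConstants ((fun i => ((y i).re : ℂ)) '' T) (2 * r + 2 * #T) := by
  have hconj : ComputableWithin freeConstants (starRingEnd ℂ '' (y '' T)) r :=
    (h.map (starRingEnd ℂ)).mono conj_image_freeConstants_subset subset_rfl le_rfl
  refine ((h.union hconj).bind (ComputableWithin.image (a := 2) T _ fun i hi => ?_)).mono_cost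
    (by linarith)
  rw [Complex.re_eq_add_conj]
  exact (((ComputableWithin.mem (Or.inr (Or.inl ⟨i, hi, rfl⟩))).add
    (ComputableWithin.mem (Or.inr (Or.inr ⟨y i, ⟨i, hi, rfl⟩, rfl⟩)))).div
    (ComputableWithin.mem (Or.inl (by simpa using natCast_mem_freeConstants 2)))
    two_ne_zero).mono_cost (by norm_num)

end RealPart

section RealScheme

open Lagrange

variable {n s : ℕ}

theorem node_ne_zero (k : Fin n) : node n k ≠ 0 := pow_ne_zero _ (omega_ne_zero n)

theorem node_injective (n : ℕ) : Function.Injective (node n) := fun i j h =>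
  Fin.ext ((isPrimitiveRoot_omega i.pos.ne').pow_inj i.2 j.2 h)

/-- The first column of the real encoding matrix: the coefficients of the BCH generator
polynomial. -/
noncomputable def realCodeword (n s : ℕ) (i : Fin n) : ℝ := ((bchGenerator n s).coeff i).re

theorem ofReal_realCodeword (hs : s < n) (hodd : ¬ n ≡ s [MOD 2]) (i : Fin n) :
    (realCodeword n s i : ℂ) = (bchGenerator n s).coeff i :=
  Complex.conj_eq_iff_re.1 (conj_coeff_bchGenerator hs hodd i)

theorem realCodeword_ne_zero_iff (hs : s < n) (hodd : ¬ n ≡ s [MOD 2]) (i : Fin n) :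
    realCodeword n s i ≠ 0 ↔ (i : ℕ) ≤ s := by
  rw [← coeff_bchGenerator_ne_zero_iff hs, ← ofReal_realCodeword hs hodd, Complex.ofReal_ne_zero]

theorem circulant_realCodeword_map_ofReal (hs : s < n) (hodd : ¬ n ≡ s [MOD 2]) :
    (Matrix.circulant (realCodeword n s)).map Complex.ofReal =
      cyclicShiftMatrix fun i => (bchGenerator n s).coeff i := by
  rw [Matrix.map_circulant, cyclicShiftMatrix]
  simp_rw [ofReal_realCodeword hs hodd]

/-- A complex decoding vector for the BCH code and the stragglers `S`: the normalized values of a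
locator polynomial of `S` all of whose exponents except `0` belong to roots of the generator. -/
noncomputable def bchDecoder (n s : ℕ) (S : Finset (Fin n)) (i : Fin n) : ℂ :=
  (gapLocator S (node n) ((n - s + 1) / 2)).eval (node n i) / (bchGenerator n s).eval 1

theorem bchDecoder_eq_zero {S : Finset (Fin n)} {i : Fin n} (hi : i ∈ S) :
    bchDecoder n s S i = 0 := by
  rw [bchDecoder, eval_gapLocator_at_node (node_injective n).injOn hi (node_ne_zero i), zero_div]

theorem vecMul_bchDecoder (hs : s < n) {S : Finset (Fin n)} (hS : #S = s) :
    Matrix.vecMul (bchDecoder n s S)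
      (cyclicShiftMatrix fun i => (bchGenerator n s).coeff i) = 1 := by
  have hcoeff : (gapLocator S (node n) ((n - s + 1) / 2)).coeff 0 = 1 :=
    coeff_zero_gapLocator (by omega)
  have hsum : ∑ i : Fin n, (bchGenerator n s).coeff i = (bchGenerator n s).eval 1 := by
    simpa using sum_coeff_bchGenerator_mul_pow hs 1
  have h := vecMul_eval_pow_div_circulant (omega_pow_order (by omega))
    (c := fun i : Fin n => (bchGenerator n s).coeff i)
    (P := gapLocator S (node n) ((n - s + 1) / 2)) (fun e he hPe => ?_)
    (by rw [hcoeff, hsum, one_mul]; exact eval_one_bchGenerator_ne_zero hs)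
  · rwa [hcoeff, hsum, one_mul] at h
  · obtain ⟨hbe, heb⟩ :=
      exponent_mem_of_coeff_gapLocator_ne_zero (node_injective n).injOn he hPe
    rw [sum_coeff_bchGenerator_mul_pow hs, eval_bchGenerator_eq_zero hbe (hS ▸ heb)]

theorem neg_inv_node_pow_mem_freeConstants (k : Fin n) (b : ℕ) :
    -(node n k ^ b)⁻¹ ∈ freeConstants :=
  neg_mem_freeConstants (mem_freeConstants_of_pow_eq_one k.pos (by
    rw [inv_pow, pow_right_comm, node_pow_card, one_pow, inv_one]))

theorem computableWithin_nodalWeight_mul (S : Finset (Fin n)) (b : ℕ) :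
    ComputableWithin freeConstants
      ((fun k => nodalWeight S (node n) k * -(node n k ^ b)⁻¹) '' S)
      (#S * (2 * #Sᶜ + 3)) := by
  refine ComputableWithin.image S _ fun k hk => ?_
  have hn : (n : ℂ) ≠ 0 := Nat.cast_ne_zero.2 k.pos.ne'
  have hnode : ∀ j, ComputableWithin freeConstants {node n j} 0 := fun j =>
    ComputableWithin.mem (node_mem_freeConstants j)
  have hweight : nodalWeight S (node n) k =
      (∏ j ∈ Sᶜ, (node n k - node n j)) * (node n k / n) :=
    nodalWeight_pow (isPrimitiveRoot_omega k.pos.ne') hk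
  rw [hweight]
  exact (((ComputableWithin.prod one_mem_freeConstants Sᶜ _ fun j _ =>
    (hnode k).sub (hnode j)).mul ((hnode k).div
      (ComputableWithin.mem (natCast_mem_freeConstants n)) hn)).mul (ComputableWithin.mem
        (neg_inv_node_pow_mem_freeConstants k b))).mono_cost (by linarith)

theorem computableWithin_eval_gapLocator (S : Finset (Fin n)) (b : ℕ) :
    ComputableWithin freeConstants
      ((fun i => (gapLocator S (node n) b).eval (node n i)) '' (Sᶜ : Finset (Fin n)))
      (#S * (2 * #Sᶜ + 3) + #Sᶜ * (5 * #S + 3)) := by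
  refine (computableWithin_nodalWeight_mul S b).bind (ComputableWithin.image Sᶜ _ fun i hi => ?_)
  set weights := (fun k => nodalWeight S (node n) k * -(node n k ^ b)⁻¹) '' S
  have hne : ∀ k ∈ S, node n i ≠ node n k := fun k hk h =>
    mem_compl.1 hi (node_injective n h ▸ hk)
  have hnode : ∀ j, ComputableWithin (freeConstants ∪ weights) {node n j} 0 := fun j =>
    ComputableWithin.mem (Or.inl (node_mem_freeConstants j))
  have hpow : ComputableWithin (freeConstants ∪ weights) {node n i ^ b} 0 :=
    ComputableWithin.mem (Or.inl (pow_mem_freeConstants i.pos (node_pow_card i) b))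
  have hone : ComputableWithin (freeConstants ∪ weights) {1} 0 :=
    ComputableWithin.mem (Or.inl one_mem_freeConstants)
  have hlocator := ComputableWithin.prod (Or.inl one_mem_freeConstants) S
    (fun k => node n i - node n k) fun k _ => (hnode i).sub (hnode k)
  have hsum := ComputableWithin.sum (Or.inl zero_mem_freeConstants) S
    (fun k => nodalWeight S (node n) k * -(node n k ^ b)⁻¹ / (node n i - node n k))
    fun k hk => (ComputableWithin.mem (I := freeConstants ∪ weights) (Or.inr ⟨k, hk, rfl⟩)).div
      ((hnode i).sub (hnode k)) (sub_ne_zero.2 (hne k hk))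
  rw [eval_gapLocator_not_at_node hne]
  exact (hone.add (hpow.mul (hlocator.mul hsum))).mono_cost (by linarith)

theorem computableWithin_eval_one_bchGenerator (n s : ℕ) :
    ComputableWithin freeConstants {(bchGenerator n s).eval 1} (s * 2) := by
  rw [bchGenerator_eq_nodal, eval_nodal]
  simpa [one_add_one_eq_two] using ComputableWithin.prod one_mem_freeConstants (range s)
    (fun k => 1 - omega n ^ ((n - s + 1) / 2 + k)) fun k _ =>
      (ComputableWithin.mem one_mem_freeConstants).sub
        (ComputableWithin.mem (omega_pow_mem_freeConstants n _))

theorem computableWithin_bchDecoder (hs : s < n) (S : Finset (Fin n)) :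
    ComputableWithin freeConstants (bchDecoder n s S '' (Sᶜ : Finset (Fin n)))
      (7 * (#S * #Sᶜ) + 3 * #S + 4 * #Sᶜ + 2 * s) := by
  refine (((computableWithin_eval_gapLocator S ((n - s + 1) / 2)).union
    (computableWithin_eval_one_bchGenerator n s)).bind
      (ComputableWithin.image (a := 1) Sᶜ _ fun i hi => ?_)).mono_cost (by linarith)
  exact ((ComputableWithin.mem (Or.inr (Or.inl ⟨i, hi, rfl⟩))).div (ComputableWithin.mem
    (Or.inr (Or.inr rfl))) (eval_one_bchGenerator_ne_zero hs)).mono_cost (by norm_num)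

theorem bchDecoder_zero_empty (i : Fin n) : bchDecoder n 0 ∅ i = 1 := by
  simp [bchDecoder, gapLocator, bchGenerator]

theorem computableWithin_re_bchDecoder (hs : s < n) {S : Finset (Fin n)} (hS : #S = s) :
    ComputableWithin freeConstants (Set.range fun i => ((bchDecoder n s S i).re : ℂ))
      (34 * (s * (n - s))) := by
  rcases Nat.eq_zero_or_pos s with rfl | hs0
  · obtain rfl := card_eq_zero.1 hS
    refine (ComputableWithin.of_subset ?_).mono_cost (by simp)
    rintro _ ⟨i, rfl⟩
    simpa [bchDecoder_zero_empty] using one_mem_freeConstants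
  have hcard : (#Sᶜ : ℝ) = n - s := by
    rw [card_compl, Fintype.card_fin, hS, Nat.cast_sub hs.le]
  refine ((computableWithin_image_re (computableWithin_bchDecoder hs S)).union
    (ComputableWithin.mem zero_mem_freeConstants)).mono subset_rfl ?_ ?_
  · rintro _ ⟨i, rfl⟩
    by_cases hi : i ∈ S
    · exact Or.inr (by simp [bchDecoder_eq_zero hi])
    · exact Or.inl ⟨i, by simpa using hi, rfl⟩
  · rw [hS, hcard]
    have hs1 : (1 : ℝ) ≤ s := mod_cast hs0
    have hns1 : (1 : ℝ) ≤ n - s := by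
      rw [← Nat.cast_sub hs.le]
      exact_mod_cast Nat.sub_pos_of_lt hs
    have hs_le : (s : ℝ) ≤ s * (n - s) := le_mul_of_one_le_right (by linarith) hns1
    have hns_le : (n - s : ℝ) ≤ s * (n - s) := le_mul_of_one_le_left (by linarith) hs1
    linarith

theorem exists_realScheme (hs : s < n) (hodd : ¬ n ≡ s [MOD 2]) :
    ∃ A : Finset (Fin n) → Fin n → ℝ,
      OptimalExactScheme s A (Matrix.circulant (realCodeword n s)) ∧
      ∀ K : Finset (Fin n), n - s ≤ #K →
        ComputableWithin freeConstants (Set.range fun i => (A K i : ℂ)) (34 * (s * (n - s))) := by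
  obtain ⟨A, hA, hcost⟩ := exists_exactComputation hs
    (p := fun a : Fin n → ℝ => ComputableWithin freeConstants (Set.range fun i => (a i : ℂ))
      (34 * (s * (n - s)))) (B := Matrix.circulant (realCodeword n s)) fun S hS =>
    ⟨fun i => (bchDecoder n s S i).re,
      fun i hi => by simp [bchDecoder_eq_zero hi],
      vecMul_re_eq_one (by
        rw [circulant_realCodeword_map_ofReal hs hodd, vecMul_bchDecoder hs hS]),
      computableWithin_re_bchDecoder hs hS⟩
  exact ⟨A, optimalExactScheme_circulant hs (realCodeword_ne_zero_iff hs hodd) hA, hcost⟩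

end RealScheme

theorem mainTheorem4_general {n s : ℕ} (hs : s < n) :
    (∃ A : Finset (Fin n) → Fin n → ℂ,
      OptimalExactScheme s A (cyclicShiftMatrix (complexCodeword n s)) ∧
      ComputableWithin freeConstants (entries (cyclicShiftMatrix (complexCodeword n s)))
        (4 * (s * (n - s))) ∧
      ∀ K : Finset (Fin n), n - s ≤ #K → ComputableWithin freeConstants (Set.range (A K))
        (1000 * (s * Real.log s ^ 2 + n * Real.log n))) ∧
    (¬ n ≡ s [MOD 2] → ∃ (A : Finset (Fin n) → Fin n → ℝ) (B : Matrix (Fin n) (Fin n) ℝ),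
      B.map (fun x : ℝ => (x : ℂ)) = cyclicShiftMatrix (fun i => (bchGenerator n s).coeff i) ∧
      OptimalExactScheme s A B ∧
      ComputableWithin freeConstants (entries (B.map (fun x : ℝ => (x : ℂ)))) ((s - 1 : ℕ) * 5) ∧
      ∀ K : Finset (Fin n), n - s ≤ #K →
        ComputableWithin freeConstants (Set.range fun i => (A K i : ℂ)) (34 * (s * (n - s)))) := by
  refine ⟨?_, fun hodd => ?_⟩
  · obtain ⟨A, hA, hdecode⟩ := exists_complexScheme hs
    refine ⟨A, hA, ?_, hdecode⟩
    rw [cyclicShiftMatrix, entries_circulant]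
    exact computableWithin_complexCodeword hs
  · obtain ⟨A, hA, hdecode⟩ := exists_realScheme hs hodd
    refine ⟨A, _, circulant_realCodeword_map_ofReal hs hodd, hA, ?_, hdecode⟩
    refine (computableWithin_coeff_bchGenerator hs).mono_target ?_
    rw [circulant_realCodeword_map_ofReal hs hodd, cyclicShiftMatrix, entries_circulant]
    rintro _ ⟨i, rfl⟩
    exact ⟨i, rfl⟩

end GradientCoding

open GradientCoding in
theorem mainTheorem4 :
    ∃ C : ℝ, 0 < C ∧ ∀ n s : ℕ, s < n →
      (∃ (A : Finset (Fin n) → Fin n → ℂ) (B : Matrix (Fin n) (Fin n) ℂ),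
        B = cyclicShiftMatrix (complexCodeword n s) ∧
        OptimalExactScheme s A B ∧
        ComputableWithin freeConstants (entries B) (C * ((s : ℝ) * ((n : ℝ) - s))) ∧
        ∀ K : Finset (Fin n), n - s ≤ K.card →
          ComputableWithin freeConstants (Set.range (A K))
            (C * ((s : ℝ) * Real.log s ^ 2 + (n : ℝ) * Real.log n))) ∧
      (¬ n ≡ s [MOD 2] →
        ∃ (A : Finset (Fin n) → Fin n → ℝ) (B : Matrix (Fin n) (Fin n) ℝ),
          B.map (fun x : ℝ => (x : ℂ)) =
            cyclicShiftMatrix (fun i : Fin n => (bchGenerator n s).coeff i) ∧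
          OptimalExactScheme s A B ∧
          ComputableWithin freeConstants (entries (B.map (fun x : ℝ => (x : ℂ))))
            (C * min ((s : ℝ) * Real.log s ^ 2) ((n : ℝ) * Real.log n)) ∧
          ∀ K : Finset (Fin n), n - s ≤ K.card →
            ComputableWithin freeConstants (Set.range fun i => ((A K i : ℝ) : ℂ))
              (C * ((vandermondeInversionCost s : ℝ) + (s : ℝ) * ((n : ℝ) - s)))) := by
  refine ⟨1000, by norm_num, fun n s hs => ?_⟩
  have hstorage : 0 ≤ (s : ℝ) * (n - s) :=
    mul_nonneg s.cast_nonneg (sub_nonneg.2 (mod_cast hs.le))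
  have hlog : 0 ≤ min ((s : ℝ) * Real.log s ^ 2) (n * Real.log n) :=
    le_min (by positivity) (mul_nonneg n.cast_nonneg (Real.log_natCast_nonneg n))
  obtain ⟨⟨A, hA, hencode, hdecode⟩, hreal⟩ := mainTheorem4_general hs
  refine ⟨⟨A, _, rfl, hA, hencode.mono_cost (by linarith), hdecode⟩, fun hodd => ?_⟩
  obtain ⟨A, B, hB, hA, hencode, hdecode⟩ := hreal hodd
  exact ⟨A, B, hB, hA, hencode.mono_cost (by linarith [pred_le_four_mul_min_log hs]),
    fun K hK => (hdecode K hK).mono_cost (by linarith)⟩
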